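/- Let $\mathbb{R}^{4,2}$ be $\mathbb{R}^6$ with a symmetric bilinear form $\langle\cdot,\cdot\rangle$ of signature $(4,2)$. For $\mathfrak a$ with $\langle\mathfrak a,\mathfrak a\rangle\neq 0$ the Lie inversion $\sigma_a$ is the linear map $\sigma_a(\mathfrak r)=\mathfrak r-\frac{2\langle\mathfrak r,\mathfrak a\rangle}{\langle\mathfrak a,\mathfrak a\rangle}\mathfrak a$. Spheres are the null lines of $\mathbb{R}^{4,2}$, and a contact element is a $2$-dimensional totally isotropic subspace. A Legendre map is a smooth immersed family $f$ of contact elements over a surface $M^2$ such that $\langle \mathfrak s_1,d\mathfrak s_2\rangle=0$ for all local smooth sections $\mathfrak s_1,\mathfrak s_2$ of $f$. A curvature direction of $f$ at $p$ is a tangent vector $X\neq 0$ for which some local smooth section $\mathfrak s$ of $f$ satisfies $\mathfrak s(p)\ne 0$ and $d_X\mathfrak s\in f(p)$. Two Legendre maps $f,\hat f$ on $M^2$ form a Ribaucour pair if $f(p)\cap\hat f(p)$ is exactly one sphere $r(p)$ for every $p\in M^2$ (so that both envelop the sphere congruence $r$) and $f,\hat f$ have the same curvature directions at every point. A Dupin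 cyclide $\Delta$ is an orthogonal splitting $\mathbb{R}^{4,2}=D_1\oplus_\perp D_2$ into two $3$-dimensional subspaces of signature $(2,1)$; its contact elements are the subspaces $\operatorname{span}(\mathfrak s^1,\mathfrak s^2)$ with nonzero null vectors $\mathfrak s^1\in D_1$, $\mathfrak s^2\in D_2$. Two Dupin cyclides $\Delta,\hat\Delta$ are Ribaucour related if over some connected surface patch (a nonempty connected open subset of $\mathbb{R}^2$) there are Legendre maps $f,\hat f$, whose values are contact elements of $\Delta$ and of $\hat\Delta$ respectively, that form a Ribaucour pair. Proposition. Two Dupin cyclides $\Delta$ and $\hat\Delta$ are Ribaucour related if and only if, for a suitable labelling of the splittings $\Delta=D_1\oplus_\perp D_2$ and $\hat\Delta=\hat D_1\oplus_\perp\hat D_2$, there is a single Lie inversion $\sigma$ such that $\hat D_1=\sigma(D_1)$ and $\hat D_2=\sigma(D_2)$. -/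

import Mathlib

open scoped ContDiff

namespace LieSphere

/-- The underlying vector space of `ℝ^{4,2}`. -/
abbrev R42 : Type := Fin 6 → ℝ

/-- The metric `⟨x, y⟩ = x₀y₀ + x₁y₁ + x₂y₂ + x₃y₃ - x₄y₄ - x₅y₅` of signature `(4,2)`. -/
noncomputable def form : LinearMap.BilinForm ℝ R42 :=
  Matrix.toBilin' (Matrix.diagonal ![1, 1, 1, 1, -1, -1])

/-- The Lie inversion `σ_a : r ↦ r - (2⟨r, a⟩ / ⟨a, a⟩) a`; it is meaningful for `⟨a, a⟩ ≠ 0`. -/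
noncomputable def lieInversion (a : R42) : R42 →ₗ[ℝ] R42 where
  toFun r := r - (2 * form r a / form a a) • a
  map_add' x y := by
    simp only [map_add, LinearMap.add_apply]
    module
  map_smul' c x := by
    simp only [map_smul, LinearMap.smul_apply, smul_eq_mul, RingHom.id_apply]
    module

/-- `σ` is the Lie inversion with respect to some elliptic or hyperbolic linear sphere complex. -/
def IsLieInversion (σ : R42 →ₗ[ℝ] R42) : Prop :=
  ∃ a : R42, form a a ≠ 0 ∧ σ = lieInversion a

/-- `D` is a `(2,1)`-plane: a 3-dimensional subspace on which the metric has signature `(2,1)`,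
i.e. it has a pseudo-orthonormal basis of type `(+,+,-)`. -/
def IsPlane21 (D : Submodule ℝ R42) : Prop :=
  ∃ b : Fin 3 → R42, LinearIndependent ℝ b ∧ Submodule.span ℝ (Set.range b) = D ∧
    ∀ i j, form (b i) (b j) = if i = j then ![(1 : ℝ), 1, -1] i else 0

/-- A contact element: a 2-dimensional totally isotropic subspace, that is, a line in the Lie
quadric. -/
def IsContactElement (c : Submodule ℝ R42) : Prop :=
  Module.finrank ℝ c = 2 ∧ ∀ x ∈ c, ∀ y ∈ c, form x y = 0

/-- `s` is, near `p`, a smooth section of the family of subspaces `f`. -/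
def IsSmoothSectionAt (f : ℝ × ℝ → Submodule ℝ R42) (p : ℝ × ℝ) (s : ℝ × ℝ → R42) : Prop :=
  ∃ W : Set (ℝ × ℝ), IsOpen W ∧ p ∈ W ∧ ContDiffOn ℝ ∞ s W ∧ ∀ q ∈ W, s q ∈ f q

/-- `f` is a Legendre map on the open set `U`: a smooth 2-parameter (i.e. immersed) family of
contact elements that satisfies the contact condition `⟨s, dt⟩ = 0` for all sections `s, t`. -/
structure IsLegendreMap (U : Set (ℝ × ℝ)) (f : ℝ × ℝ → Submodule ℝ R42) : Prop where
  contactElement : ∀ p ∈ U, IsContactElement (f p)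
  smooth : ∀ p ∈ U, ∃ (W : Set (ℝ × ℝ)) (s t : ℝ × ℝ → R42), IsOpen W ∧ p ∈ W ∧
    ContDiffOn ℝ ∞ s W ∧ ContDiffOn ℝ ∞ t W ∧ ∀ q ∈ W, f q = Submodule.span ℝ {s q, t q}
  contact : ∀ p ∈ U, ∀ s t : ℝ × ℝ → R42, IsSmoothSectionAt f p s → IsSmoothSectionAt f p t →
    ∀ X : ℝ × ℝ, form (s p) (fderiv ℝ t p X) = 0
  immersion : ∀ p ∈ U, ∀ X : ℝ × ℝ,
    (∀ s : ℝ × ℝ → R42, IsSmoothSectionAt f p s → fderiv ℝ s p X ∈ f p) → X = 0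

/-- The nonzero tangent vector `X` at `p` is a curvature direction of `f`: some sphere `⟨s(p)⟩` of
the contact element `f(p)` (the curvature sphere) is in contact of higher order along `X`, i.e.
`s` is a smooth section of `f` with `s(p) ≠ 0` and `d_X s ∈ f(p)`. -/
def IsCurvatureDirection (f : ℝ × ℝ → Submodule ℝ R42) (p X : ℝ × ℝ) : Prop :=
  X ≠ 0 ∧ ∃ s : ℝ × ℝ → R42, IsSmoothSectionAt f p s ∧ s p ≠ 0 ∧ fderiv ℝ s p X ∈ f p

/-- `f` and `g` form a Ribaucour pair: they are Legendre maps which at each point have exactly one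
common sphere `r = f ∩ g` (so both envelop the sphere congruence `r`), and their curvature
directions, hence their curvature lines, correspond. -/
structure IsRibaucourPair (U : Set (ℝ × ℝ)) (f g : ℝ × ℝ → Submodule ℝ R42) : Prop where
  legendre_left : IsLegendreMap U f
  legendre_right : IsLegendreMap U g
  common_sphere : ∀ p ∈ U, Module.finrank ℝ (f p ⊓ g p : Submodule ℝ R42) = 1
  curvature : ∀ p ∈ U, ∀ X : ℝ × ℝ, IsCurvatureDirection f p X ↔ IsCurvatureDirection g p X

/-- A Dupin cyclide, given (with some labelling) by an orthogonal splitting of `ℝ^{4,2}` into two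
`(2,1)`-planes. -/
structure DupinCyclide where
  plane : Fin 2 → Submodule ℝ R42
  isPlane21 : ∀ i, IsPlane21 (plane i)
  isCompl : IsCompl (plane 0) (plane 1)
  orthogonal : ∀ x ∈ plane 0, ∀ y ∈ plane 1, form x y = 0

/-- The contact elements of a Dupin cyclide: those spanned by a curvature sphere in one plane and a
curvature sphere in the other one. -/
def DupinCyclide.contactElements (Δ : DupinCyclide) : Set (Submodule ℝ R42) :=
  {c | ∃ s : Fin 2 → R42, (∀ i, s i ∈ Δ.plane i ∧ s i ≠ 0 ∧ form (s i) (s i) = 0) ∧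
    c = Submodule.span ℝ (Set.range s)}

/-- Two Dupin cyclides are Ribaucour related (form a Ribaucour pair): they have simultaneous
parametrizations over a surface patch, as Legendre maps, that form a Ribaucour pair. -/
def DupinCyclide.RibaucourRelated (Δ Δ' : DupinCyclide) : Prop :=
  ∃ (U : Set (ℝ × ℝ)) (f f' : ℝ × ℝ → Submodule ℝ R42), IsOpen U ∧ IsConnected U ∧
    (∀ p ∈ U, f p ∈ Δ.contactElements) ∧ (∀ p ∈ U, f' p ∈ Δ'.contactElements) ∧
    IsRibaucourPair U f f'

end LieSphere

open scoped ContDiff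

namespace LieSphere

open Module Submodule

/-! Near any point a Legendre map into a Dupin cyclide is spanned by two conics of null vectors, one
in each plane of the splitting, with parameters `u 0` and `u 1`. Its curvature directions are the
kernels of `du 0` and `du 1` (`IsConicForm.isCurvatureDirection_iff`). For a Ribaucour pair these
kernels agree, so in the coordinates `(u 0, u 1)` each parameter of the second map depends on one
coordinate only. After relabelling, the contact elements are spanned by `s₀(t), s₁(v)` and by
`s₀'(t), s₁'(v)`.

A common sphere is a relation `α s₀ + β s₁ = α' s₀' + β' s₁'`. Regrouped, it says that the
projective line through `s₀(t), s₀'(t)` meets the line through `s₁(v), s₁'(v)`, for all `t` and `v`.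
Two such families of lines pass through one point `a`, unless a family is coplanar or both lie in a
projective 3-space (`exists_common_of_meet`). The latter fails because the two planes span all six
dimensions; the former would make two corresponding planes equal, a case settled directly. The
vector `a` is not null, since otherwise it would be orthogonal to everything, and the inversion in
`a` exchanges the lines of `sᵢ(t)` and `sᵢ'(t)`, hence maps plane to plane.

Conversely, if the inversion in `a` relates the splittings, it carries a conic parametrization of
one cyclide to one of the other with the same parameters. Curvature directions then agree, and the
common sphere is the part of the contact element orthogonal to `a` (`finrank_inf_map_lieInversion`).
-/

lemma form_comm (x y : R42) : form x y = form y x := by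
  simp only [form, Matrix.toBilin'_apply', Matrix.mulVec_diagonal, dotProduct]
  exact Finset.sum_congr rfl fun i _ => by ring

/-! ### Incidence of projective lines. -/

section Incidence

variable {V : Type*} [AddCommGroup V] [Module ℝ V]

lemma le_of_mem_of_notMem_span {W P : Submodule ℝ V} (hW : finrank ℝ W = 2) {x y : V}
    (hx : x ∈ W) (hy : y ∈ W) (hx0 : x ≠ 0) (hxy : y ∉ span ℝ {x}) (hxP : x ∈ P) (hyP : y ∈ P) :
    W ≤ P := by
  have : FiniteDimensional ℝ W := FiniteDimensional.of_finrank_eq_succ hW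
  have hli : LinearIndependent ℝ ![x, y] := by
    rw [LinearIndependent.pair_iff' hx0]
    exact fun c hc => hxy (mem_span_singleton.2 ⟨c, hc⟩)
  have hle : span ℝ (Set.range ![x, y]) ≤ W := by
    rw [span_le]
    rintro _ ⟨i, rfl⟩
    fin_cases i <;> simpa
  have heq : span ℝ (Set.range ![x, y]) = W :=
    eq_of_le_of_finrank_eq hle (by rw [finrank_span_eq_card hli, hW]; rfl)
  rw [← heq, span_le]
  rintro _ ⟨i, rfl⟩
  fin_cases i <;> simpa

lemma le_sup_of_meets {W X Y : Submodule ℝ V} (hW : finrank ℝ W = 2) (hXY : X ⊓ Y = ⊥)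
    (hX : W ⊓ X ≠ ⊥) (hY : W ⊓ Y ≠ ⊥) : W ≤ X ⊔ Y := by
  obtain ⟨x, hx, hx0⟩ := exists_mem_ne_zero_of_ne_bot hX
  obtain ⟨y, hy, hy0⟩ := exists_mem_ne_zero_of_ne_bot hY
  refine le_of_mem_of_notMem_span hW hx.1 hy.1 hx0 (fun h => hy0 ?_) (mem_sup_left hx.2)
    (mem_sup_right hy.2)
  have : y ∈ X ⊓ Y := ⟨(span_singleton_le_iff_mem _ _).2 hx.2 h, hy.2⟩
  simpa [hXY] using this

variable [FiniteDimensional ℝ V] {I J : Type*} [Nonempty I]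
  {W₁ : I → Submodule ℝ V} {W₂ : J → Submodule ℝ V}

/-- Pairwise intersecting lines which are not coplanar are concurrent. -/
lemma exists_common_of_pairwise_meet (h₁ : ∀ i, finrank ℝ (W₁ i) = 2)
    (hmeet : ∀ i i', W₁ i ⊓ W₁ i' ≠ ⊥)
    (hdim : ∀ P : Submodule ℝ V, (∀ i, W₁ i ≤ P) → 3 < finrank ℝ P) :
    ∃ a ≠ 0, ∀ i, a ∈ W₁ i := by
  obtain ⟨i₀⟩ := ‹Nonempty I›
  obtain ⟨i₁, hi₁⟩ : ∃ i₁, ¬ W₁ i₁ ≤ W₁ i₀ := by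
    by_contra! h
    have := hdim _ h
    rw [h₁] at this
    omega
  obtain ⟨a, ha, ha0⟩ := exists_mem_ne_zero_of_ne_bot (hmeet i₀ i₁)
  obtain ⟨k₀, hk₀⟩ : ∃ k₀, ¬ W₁ k₀ ≤ W₁ i₀ ⊔ W₁ i₁ := by
    by_contra! h
    have h3 := hdim _ h
    have h4 := finrank_sup_add_finrank_inf_eq (W₁ i₀) (W₁ i₁)
    have h5 := one_le_finrank_iff.2 (hmeet i₀ i₁)
    rw [h₁, h₁] at h4
    omega
  -- A line outside the plane of the lines `i₀`, `i₁` meets that plane in one point, so it meets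
  -- both lines in their intersection `a`.
  have key : ∀ k, ¬ W₁ k ≤ W₁ i₀ ⊔ W₁ i₁ → a ∈ W₁ k := by
    intro k hk
    obtain ⟨x, hx, hx0⟩ := exists_mem_ne_zero_of_ne_bot (hmeet k i₀)
    obtain ⟨y, hy, hy0⟩ := exists_mem_ne_zero_of_ne_bot (hmeet k i₁)
    have hyx : y ∈ span ℝ {x} := by
      by_contra h
      exact hk (le_of_mem_of_notMem_span (h₁ k) hx.1 hy.1 hx0 h (mem_sup_left hx.2)
        (mem_sup_right hy.2))
    have hy₀ : y ∈ W₁ i₀ := (span_singleton_le_iff_mem _ _).2 hx.2 hyx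
    have hay : a ∈ span ℝ {y} := by
      by_contra h
      exact hi₁ (le_of_mem_of_notMem_span (h₁ i₁) hy.2 ha.2 hy0 h hy₀ ha.1)
    exact (span_singleton_le_iff_mem _ _).2 hy.1 hay
  refine ⟨a, ha0, fun k => ?_⟩
  -- A line inside the plane still meets the line `k₀`, whose only point in the plane is `a`.
  by_cases hk : W₁ k ≤ W₁ i₀ ⊔ W₁ i₁
  · obtain ⟨z, hz, hz0⟩ := exists_mem_ne_zero_of_ne_bot (hmeet k k₀)
    have haz : a ∈ span ℝ {z} := by
      by_contra h
      exact hk₀ (le_of_mem_of_notMem_span (h₁ k₀) hz.2 (key k₀ hk₀) hz0 h (hk hz.1)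
        (mem_sup_left ha.1))
    exact (span_singleton_le_iff_mem _ _).2 hz.1 haz
  · exact key k hk

/-- The first family passes through a point `a`. If some `W₂ j` missed `a`, each `W₁ i` would join
`a` to a point of `W₂ j`, so the first family would lie in the plane spanned by `a` and `W₂ j`. -/
lemma exists_common_of_left_meet (h₁ : ∀ i, finrank ℝ (W₁ i) = 2)
    (h₂ : ∀ j, finrank ℝ (W₂ j) = 2) (hmeet : ∀ i j, W₁ i ⊓ W₂ j ≠ ⊥)
    (hmeet' : ∀ i i', W₁ i ⊓ W₁ i' ≠ ⊥)
    (hdim : ∀ P : Submodule ℝ V, (∀ i, W₁ i ≤ P) → 3 < finrank ℝ P) :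
    ∃ a ≠ 0, (∀ i, a ∈ W₁ i) ∧ ∀ j, a ∈ W₂ j := by
  obtain ⟨a, ha0, ha⟩ := exists_common_of_pairwise_meet h₁ hmeet' hdim
  refine ⟨a, ha0, ha, fun j => ?_⟩
  by_contra hj
  have h3 := hdim (W₂ j ⊔ span ℝ {a}) fun i => by
    obtain ⟨x, hx, hx0⟩ := exists_mem_ne_zero_of_ne_bot (hmeet i j)
    exact le_of_mem_of_notMem_span (h₁ i) hx.1 (ha i) hx0
      (fun h => hj ((span_singleton_le_iff_mem _ _).2 hx.2 h)) (mem_sup_left hx.2)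
      (mem_sup_right (mem_span_singleton_self a))
  have h4 := finrank_add_le_finrank_add_finrank (W₂ j) (span ℝ {a})
  rw [h₂, finrank_span_singleton ha0] at h4
  omega

/-- Two families of lines such that every line of one meets every line of the other are concurrent,
unless a family is coplanar or both families lie in a common 3-dimensional projective space. -/
lemma exists_common_of_meet [Nonempty J] (h₁ : ∀ i, finrank ℝ (W₁ i) = 2)
    (h₂ : ∀ j, finrank ℝ (W₂ j) = 2) (hmeet : ∀ i j, W₁ i ⊓ W₂ j ≠ ⊥)
    (hdim₁ : ∀ P : Submodule ℝ V, (∀ i, W₁ i ≤ P) → 3 < finrank ℝ P)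
    (hdim₂ : ∀ P : Submodule ℝ V, (∀ j, W₂ j ≤ P) → 3 < finrank ℝ P)
    (hdim : ∀ P : Submodule ℝ V, (∀ i, W₁ i ≤ P) → (∀ j, W₂ j ≤ P) → 4 < finrank ℝ P) :
    ∃ a ≠ 0, (∀ i, a ∈ W₁ i) ∧ ∀ j, a ∈ W₂ j := by
  by_cases hA : ∀ i i', W₁ i ⊓ W₁ i' ≠ ⊥
  · exact exists_common_of_left_meet h₁ h₂ hmeet hA hdim₁
  have hmeet' : ∀ j i, W₂ j ⊓ W₁ i ≠ ⊥ := fun j i => by rw [inf_comm]; exact hmeet i j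
  by_cases hB : ∀ j j', W₂ j ⊓ W₂ j' ≠ ⊥
  · obtain ⟨a, h0, h1, h2⟩ := exists_common_of_left_meet h₂ h₁ hmeet' hB hdim₂
    exact ⟨a, h0, h2, h1⟩
  push Not at hA hB
  obtain ⟨i, i', hi⟩ := hA
  obtain ⟨j, j', hj⟩ := hB
  -- Both families now contain a skew pair. Every line of the second joins points of the skew lines
  -- `i`, `i'`; every line of the first joins points of `j`, `j'`. All lines thus lie in the
  -- 4-dimensional space `W₁ i ⊔ W₁ i'`.
  have hW₂ : ∀ k, W₂ k ≤ W₁ i ⊔ W₁ i' := fun k =>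
    le_sup_of_meets (h₂ k) hi (hmeet' k i) (hmeet' k i')
  have h5 := hdim (W₁ i ⊔ W₁ i') (fun k => (le_sup_of_meets (h₁ k) hj (hmeet k j)
    (hmeet k j')).trans (sup_le (hW₂ j) (hW₂ j'))) hW₂
  have h4 := finrank_add_le_finrank_add_finrank (W₁ i) (W₁ i')
  rw [h₁, h₁] at h4
  omega

end Incidence

/-! ### Nondegeneracy of (2,1)-planes and splittings. -/

lemma IsPlane21.finrank_eq {D : Submodule ℝ R42} (hD : IsPlane21 D) : finrank ℝ D = 3 := by
  obtain ⟨b, hb, rfl, -⟩ := hD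
  rw [finrank_span_eq_card hb]
  rfl

lemma IsPlane21.eq_zero_of_orthogonal {D : Submodule ℝ R42} (hD : IsPlane21 D) {x : R42}
    (hx : x ∈ D) (h : ∀ y ∈ D, form x y = 0) : x = 0 := by
  obtain ⟨b, -, rfl, hb⟩ := hD
  obtain ⟨c, rfl⟩ := (mem_span_range_iff_exists_fun ℝ).1 hx
  have key : ∀ i, c i = 0 := fun i => by
    have := h (b i) (subset_span ⟨i, rfl⟩)
    simp only [map_sum, map_smul, LinearMap.sum_apply, LinearMap.smul_apply, hb, smul_eq_mul,
      mul_ite, mul_zero, Finset.sum_ite_eq', Finset.mem_univ, if_true] at this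
    fin_cases i <;> simpa using this
  simp [key]

lemma IsPlane21.exists_form_eq_one {D : Submodule ℝ R42} (hD : IsPlane21 D) :
    ∃ x ∈ D, form x x = 1 := by
  obtain ⟨b, -, rfl, hb⟩ := hD
  exact ⟨b 0, subset_span ⟨0, rfl⟩, by simp [hb]⟩

namespace DupinCyclide

variable (Δ Δ' : DupinCyclide)

lemma form_eq_zero {i j : Fin 2} (hij : i ≠ j) {x y : R42} (hx : x ∈ Δ.plane i)
    (hy : y ∈ Δ.plane j) : form x y = 0 := by
  fin_cases i <;> fin_cases j
  · exact absurd rfl hij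
  · exact Δ.orthogonal x hx y hy
  · rw [form_comm]
    exact Δ.orthogonal y hy x hx
  · exact absurd rfl hij

lemma isCompl_plane {i j : Fin 2} (hij : i ≠ j) : IsCompl (Δ.plane i) (Δ.plane j) := by
  fin_cases i <;> fin_cases j
  · exact absurd rfl hij
  · exact Δ.isCompl
  · exact Δ.isCompl.symm
  · exact absurd rfl hij

/-- The same Dupin cyclide with another labelling of its splitting. -/
def relabel (τ : Equiv.Perm (Fin 2)) : DupinCyclide where
  plane i := Δ.plane (τ i)
  isPlane21 _ := Δ.isPlane21 _
  isCompl := Δ.isCompl_plane (τ.injective.ne zero_ne_one)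
  orthogonal _ hx _ hy := Δ.form_eq_zero (τ.injective.ne zero_ne_one) hx hy

lemma eq_zero_of_orthogonal {a : R42} (h : ∀ i, ∀ x ∈ Δ.plane i, form a x = 0) : a = 0 := by
  obtain ⟨y, hy, z, hz, rfl⟩ := mem_sup.1 (Δ.isCompl.sup_eq_top ▸ mem_top (x := a))
  have hy0 : y = 0 := (Δ.isPlane21 0).eq_zero_of_orthogonal hy fun x hx => by
    have := h 0 x hx
    rwa [map_add, LinearMap.add_apply, Δ.form_eq_zero one_ne_zero hz hx, add_zero] at this
  have hz0 : z = 0 := (Δ.isPlane21 1).eq_zero_of_orthogonal hz fun x hx => by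
    have := h 1 x hx
    rwa [map_add, LinearMap.add_apply, Δ.form_eq_zero zero_ne_one hy hx, zero_add] at this
  rw [hy0, hz0, add_zero]

variable {Δ Δ'}

/-- Each plane of a splitting is the orthogonal complement of the other. -/
lemma plane_eq_of_plane_eq {i j : Fin 2} (hij : i ≠ j) (h : Δ'.plane i = Δ.plane i) :
    Δ'.plane j = Δ.plane j := by
  refine eq_of_le_of_finrank_eq (fun x hx => ?_)
    ((Δ'.isPlane21 j).finrank_eq.trans (Δ.isPlane21 j).finrank_eq.symm)
  obtain ⟨y, hy, z, hz, rfl⟩ :=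
    mem_sup.1 ((Δ.isCompl_plane hij).sup_eq_top ▸ mem_top (x := x))
  have hy0 : y = 0 := (Δ.isPlane21 i).eq_zero_of_orthogonal hy fun w hw => by
    have := Δ'.form_eq_zero hij.symm hx (h ▸ hw)
    rwa [map_add, LinearMap.add_apply, Δ.form_eq_zero hij.symm hz hw, add_zero] at this
  rwa [hy0, zero_add]

end DupinCyclide

/-! ### Lie inversions. -/

lemma lieInversion_apply (a x : R42) :
    lieInversion a x = x - (2 * form x a / form a a) • a := rfl

lemma lieInversion_of_orthogonal {a x : R42} (h : form x a = 0) : lieInversion a x = x := by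
  simp [lieInversion_apply, h]

lemma form_lieInversion {a : R42} (ha : form a a ≠ 0) (x y : R42) :
    form (lieInversion a x) (lieInversion a y) = form x y := by
  simp only [lieInversion_apply, map_sub, map_smul, LinearMap.sub_apply, LinearMap.smul_apply,
    smul_eq_mul]
  rw [form_comm a y]
  field_simp
  ring

lemma lieInversion_lieInversion {a : R42} (ha : form a a ≠ 0) (x : R42) :
    lieInversion a (lieInversion a x) = x := by
  have h : 2 * form a a / form a a = 2 := by field_simp
  rw [lieInversion_apply a x, map_sub, map_smul, lieInversion_apply, lieInversion_apply, h]
  module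

lemma lieInversion_injective {a : R42} (ha : form a a ≠ 0) :
    Function.Injective (lieInversion a) :=
  Function.LeftInverse.injective (lieInversion_lieInversion ha)

lemma map_lieInversion_eq {a : R42} (ha : form a a ≠ 0) {D D' : Submodule ℝ R42}
    (hD : IsPlane21 D) (hD' : IsPlane21 D') (h : D ≤ D'.comap (lieInversion a)) :
    D' = D.map (lieInversion a) := by
  refine (eq_of_le_of_finrank_eq (map_le_iff_le_comap.2 h) ?_).symm
  rw [← (equivMapOfInjective _ (lieInversion_injective ha) D).finrank_eq, hD.finrank_eq,
    hD'.finrank_eq]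

/-- Here the splittings coincide, and inversion in a unit vector `a` of `plane 0` preserves both
planes: `plane 0` contains `a`, and `plane 1` is fixed pointwise. -/
lemma DupinCyclide.exists_lieInversion_of_plane_eq {Δ Δ' : DupinCyclide} {i : Fin 2}
    (h : Δ'.plane i = Δ.plane i) :
    ∃ σ, IsLieInversion σ ∧ ∀ i, Δ'.plane i = (Δ.plane i).map σ := by
  have hall : ∀ j, Δ'.plane j = Δ.plane j := fun j => by
    rcases eq_or_ne i j with rfl | hij
    · exact h
    · exact plane_eq_of_plane_eq hij h
  obtain ⟨a, ha, ha1⟩ := (Δ.isPlane21 0).exists_form_eq_one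
  have ha0 : form a a ≠ 0 := by rw [ha1]; exact one_ne_zero
  refine ⟨lieInversion a, ⟨a, ha0, rfl⟩, fun j => ?_⟩
  refine map_lieInversion_eq ha0 (Δ.isPlane21 j) (Δ'.isPlane21 j) fun x hx => ?_
  rw [mem_comap, hall]
  rcases eq_or_ne j 0 with rfl | hj
  · exact sub_mem hx (smul_mem _ _ ha)
  · rwa [lieInversion_of_orthogonal (Δ.form_eq_zero hj hx ha)]

/-! ### Families of null vectors and the point common to their connecting lines. -/

/-- A family of null vectors of `D`, every infinite subfamily of which spans `D`. -/
structure IsNullFamily {I : Type*} (D : Submodule ℝ R42) (s : I → R42) : Prop where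
  mem : ∀ t, s t ∈ D
  null : ∀ t, form (s t) (s t) = 0
  le_span : ∀ S : Set I, S.Infinite → D ≤ span ℝ (s '' S)

namespace IsNullFamily

variable {I : Type*} {D D' : Submodule ℝ R42} {s s' : I → R42}

lemma le_of_forall_mem (h : IsNullFamily D s) {S : Set I} (hS : S.Infinite)
    {P : Submodule ℝ R42} (hP : ∀ t ∈ S, s t ∈ P) : D ≤ P :=
  (h.le_span S hS).trans (span_le.2 (Set.image_subset_iff.2 hP))

lemma finite_parallel (h : IsNullFamily D s) (hD : IsPlane21 D) {a : R42} :
    {t | s t ∈ span ℝ {a}}.Finite := by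
  by_contra hinf
  have h1 := finrank_mono (h.le_of_forall_mem hinf (P := span ℝ {a}) (fun t ht => ht))
  have h2 : finrank ℝ (span ℝ {a}) ≤ 1 := by
    simpa using finrank_span_le_card (R := ℝ) ({a} : Set R42)
  rw [hD.finrank_eq] at h1
  omega

/-- Where the two null families are proportional, they take values in both planes. -/
lemma infinite_linearIndependent [Infinite I] (h : IsNullFamily D s) (h' : IsNullFamily D' s')
    (hD : IsPlane21 D) (hD' : IsPlane21 D') (hne : D' ≠ D) :
    {t | LinearIndependent ℝ ![s t, s' t]}.Infinite := by
  intro hfin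
  have hS := hfin.infinite_compl
  -- Being parallel to `0` means vanishing, so this discards the finitely many zeros of `s'`.
  have hS2 : ({t | LinearIndependent ℝ ![s t, s' t]}ᶜ \ {t | s' t ∈ span ℝ {(0 : R42)}}).Infinite :=
    hS.sdiff (h'.finite_parallel hD')
  refine hne (eq_of_le_of_finrank_eq (h.le_of_forall_mem hS2 fun t ht => ?_)
    (hD.finrank_eq.trans hD'.finrank_eq.symm)).symm
  have h1 : ¬ LinearIndependent ℝ ![s' t, s t] := fun hl =>
    ht.1 (LinearIndependent.pair_symm_iff.1 hl)
  have h2 : s' t ≠ 0 := fun h0 => ht.2 (by simp [h0])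
  rw [LinearIndependent.pair_iff' h2] at h1
  push Not at h1
  obtain ⟨c, hc⟩ := h1
  rw [← hc]
  exact smul_mem _ _ (h'.mem t)

lemma infinite_not_parallel (h : IsNullFamily D s) (h' : IsNullFamily D' s') (hD : IsPlane21 D)
    (hD' : IsPlane21 D') {S : Set I} (hS : S.Infinite) {a : R42} :
    (S \ ({t | s t ∈ span ℝ {a}} ∪ {t | s' t ∈ span ℝ {a}})).Infinite :=
  hS.sdiff ((h.finite_parallel hD).union (h'.finite_parallel hD'))

/-- A null vector in infinitely many spans of corresponding members is orthogonal to `D`. -/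
lemma orthogonal_of_null (h : IsNullFamily D s) (h' : IsNullFamily D' s') (hD : IsPlane21 D)
    (hD' : IsPlane21 D') {S : Set I} (hS : S.Infinite) {a : R42} (ha0 : a ≠ 0)
    (ha : ∀ t ∈ S, a ∈ span ℝ {s t, s' t}) (hnull : form a a = 0) : ∀ x ∈ D, form a x = 0 := by
  have hle : D ≤ LinearMap.ker (form a) := by
    refine h.le_of_forall_mem (h.infinite_not_parallel h' hD hD' hS (a := a)) fun t ht => ?_
    obtain ⟨c, d, rfl⟩ := mem_span_pair.1 (ha t ht.1)
    have hc : c ≠ 0 := by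
      rintro rfl
      refine ht.2 (Or.inr (mem_span_singleton.2 ⟨d⁻¹, ?_⟩))
      have hd : d ≠ 0 := by rintro rfl; simp at ha0
      rw [zero_smul, zero_add, smul_smul, inv_mul_cancel₀ hd, one_smul]
    have hd : d ≠ 0 := by
      rintro rfl
      refine ht.2 (Or.inl (mem_span_singleton.2 ⟨c⁻¹, ?_⟩))
      rw [zero_smul, add_zero, smul_smul, inv_mul_cancel₀ hc, one_smul]
    have hs := h.null t
    have hs' := h'.null t
    have hcomm := form_comm (s t) (s' t)
    simp only [map_add, map_smul, LinearMap.add_apply, LinearMap.smul_apply, smul_eq_mul] at hnull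
    rw [LinearMap.mem_ker]
    simp only [map_add, map_smul, LinearMap.add_apply, LinearMap.smul_apply, smul_eq_mul]
    rw [hs, hs', hcomm] at hnull
    -- For `a = c s + d s'` with both vectors null, `⟨a, a⟩ = 2cd⟨s, s'⟩`. Parameters with `a`
    -- parallel to either vector were removed, so `s ⊥ s'` and hence `s ⊥ a`.
    have h0 : c * d * form (s' t) (s t) = 0 := by linarith
    have h1 : form (s' t) (s t) = 0 := by simpa [hc, hd] using h0
    rw [hs, h1]
    ring
  exact fun x hx => hle hx

/-- If `a = c s + d s'` with `s`, `s'` null, then `⟨a, a⟩ = 2c⟨s, a⟩`, so the inversion sends `s` to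
`s - c⁻¹ a = -(d/c) s'`. -/
lemma le_comap_lieInversion (h : IsNullFamily D s) (h' : IsNullFamily D' s')
    {S : Set I} (hS : S.Infinite) {a : R42} (ha0 : form a a ≠ 0)
    (ha : ∀ t ∈ S, a ∈ span ℝ {s t, s' t}) : D ≤ D'.comap (lieInversion a) := by
  refine h.le_of_forall_mem hS fun t ht => ?_
  obtain ⟨c, d, hcd⟩ := mem_span_pair.1 (ha t ht)
  have hs := h.null t
  have hs' := h'.null t
  have h1 : form a a = 2 * c * form (s t) a := by
    rw [← hcd]
    simp only [map_add, map_smul, LinearMap.add_apply, LinearMap.smul_apply, smul_eq_mul]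
    rw [hs, hs', form_comm (s' t)]
    ring
  have hc : c ≠ 0 := by rintro rfl; simp at h1; exact ha0 h1
  have h2 : 2 * form (s t) a / form a a = c⁻¹ := by
    rw [h1] at ha0 ⊢
    have : form (s t) a ≠ 0 := right_ne_zero_of_mul ha0
    field_simp
  have h3 : lieInversion a (s t) = -(c⁻¹ * d) • s' t := by
    rw [lieInversion_apply, h2, ← hcd, smul_add, smul_smul, smul_smul, inv_mul_cancel₀ hc]
    module
  rw [mem_comap, h3]
  exact smul_mem _ _ (h'.mem t)

end IsNullFamily

/-- Move the terms of a common vector `α s₁ + β s₂ = α' t₁ + β' t₂` across; the independence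
hypotheses keep the regrouped vector nonzero. -/
lemma span_pair_inf_ne_bot {V : Type*} [AddCommGroup V] [Module ℝ V] {s₁ s₂ t₁ t₂ : V}
    (h₁ : LinearIndependent ℝ ![s₁, t₁]) (h₂ : LinearIndependent ℝ ![s₂, t₂])
    (h : span ℝ {s₁, s₂} ⊓ span ℝ {t₁, t₂} ≠ ⊥) : span ℝ {s₁, t₁} ⊓ span ℝ {s₂, t₂} ≠ ⊥ := by
  obtain ⟨r, ⟨hr, hr'⟩, hr0⟩ := exists_mem_ne_zero_of_ne_bot h
  obtain ⟨α, β, h3⟩ := mem_span_pair.1 hr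
  obtain ⟨α', β', h4⟩ := mem_span_pair.1 hr'
  rw [Submodule.ne_bot_iff]
  refine ⟨α • s₁ + (-α') • t₁, ⟨mem_span_pair.2 ⟨_, _, rfl⟩,
    mem_span_pair.2 ⟨-β, β', ?_⟩⟩, fun h0 => hr0 ?_⟩
  · linear_combination (norm := module) h4 - h3
  · obtain ⟨h5, h6⟩ := LinearIndependent.pair_iff.1 h₁ _ _ h0
    have h7 : β • s₂ + (-β') • t₂ = 0 := by
      linear_combination (norm := module) h3 - h4 - h0
    obtain ⟨h8, h9⟩ := LinearIndependent.pair_iff.1 h₂ _ _ h7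
    rw [← h3, h5, h8]
    simp

/-- The algebraic core of the forward direction: the parameters range over a product, and no
smoothness is left. -/
lemma DupinCyclide.exists_lieInversion {Δ Δ' : DupinCyclide} {I : Type*} [Infinite I]
    {s s' : Fin 2 → I → R42} (h : ∀ i, IsNullFamily (Δ.plane i) (s i))
    (h' : ∀ i, IsNullFamily (Δ'.plane i) (s' i))
    (hmeet : ∀ t u, span ℝ {s 0 t, s 1 u} ⊓ span ℝ {s' 0 t, s' 1 u} ≠ ⊥) :
    ∃ σ, IsLieInversion σ ∧ ∀ i, Δ'.plane i = (Δ.plane i).map σ := by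
  by_cases hne : ∃ i, Δ'.plane i = Δ.plane i
  · obtain ⟨i, hi⟩ := hne
    exact exists_lieInversion_of_plane_eq hi
  push Not at hne
  -- Only for these parameters do corresponding null vectors span a line.
  let S : Fin 2 → Set I := fun i => {t | LinearIndependent ℝ ![s i t, s' i t]}
  have hS : ∀ i, (S i).Infinite := fun i =>
    (h i).infinite_linearIndependent (h' i) (Δ.isPlane21 i) (Δ'.isPlane21 i) (hne i)
  have hSne : ∀ i, Nonempty (S i) := fun i => (hS i).nonempty.to_subtype
  have hrank : ∀ i (t : S i), finrank ℝ (span ℝ {s i t, s' i t}) = 2 := fun i t => by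
    have := finrank_span_eq_card t.2
    rwa [Matrix.range_cons_cons_empty, Fintype.card_fin] at this
  have hle : ∀ i (P : Submodule ℝ R42), (∀ t : S i, span ℝ {s i t, s' i t} ≤ P) →
      Δ.plane i ≤ P ∧ Δ'.plane i ≤ P := fun i P hP =>
    ⟨(h i).le_of_forall_mem (hS i) fun t ht => hP ⟨t, ht⟩ (subset_span (by simp)),
      (h' i).le_of_forall_mem (hS i) fun t ht => hP ⟨t, ht⟩ (subset_span (by simp))⟩
  have hdim : ∀ i (P : Submodule ℝ R42), (∀ t : S i, span ℝ {s i t, s' i t} ≤ P) →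
      3 < finrank ℝ P := fun i P hP => by
    by_contra! hlt
    have h1 := eq_of_le_of_finrank_le (hle i P hP).1
      (hlt.trans_eq (Δ.isPlane21 i).finrank_eq.symm)
    have h2 := eq_of_le_of_finrank_le (hle i P hP).2
      (hlt.trans_eq (Δ'.isPlane21 i).finrank_eq.symm)
    exact hne i (h2.trans h1.symm)
  obtain ⟨a, ha0, ha1, ha2⟩ := exists_common_of_meet (hrank 0) (hrank 1)
    (fun t u => span_pair_inf_ne_bot t.2 u.2 (hmeet t u)) (hdim 0) (hdim 1) fun P h0 h1 => by
      have hP : P = ⊤ := top_le_iff.1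
        (Δ.isCompl.sup_eq_top.ge.trans (sup_le (hle 0 P h0).1 (hle 1 P h1).1))
      rw [hP, finrank_top, finrank_fin_fun]
      norm_num
  have ha : ∀ i, ∀ t ∈ S i, a ∈ span ℝ {s i t, s' i t} := by
    intro i t ht
    fin_cases i
    · exact ha1 ⟨t, ht⟩
    · exact ha2 ⟨t, ht⟩
  have hnull : form a a ≠ 0 := fun h0 => ha0 <| Δ.eq_zero_of_orthogonal fun i =>
    (h i).orthogonal_of_null (h' i) (Δ.isPlane21 i) (Δ'.isPlane21 i) (hS i) ha0 (ha i) h0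
  exact ⟨lieInversion a, ⟨a, hnull, rfl⟩, fun i => map_lieInversion_eq hnull (Δ.isPlane21 i)
    (Δ'.isPlane21 i) ((h i).le_comap_lieInversion (h' i) (hS i) hnull (ha i))⟩

/-! ### Null frames and conics of null vectors. -/

/-- A basis of a `(2,1)`-plane consisting of two null vectors with product `-1` and a unit vector
orthogonal to them. -/
structure IsNullFrame (b : Fin 3 → R42) : Prop where
  form_zero_zero : form (b 0) (b 0) = 0
  form_one_one : form (b 1) (b 1) = 1
  form_two_two : form (b 2) (b 2) = 0
  form_zero_one : form (b 0) (b 1) = 0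
  form_one_two : form (b 1) (b 2) = 0
  form_zero_two : form (b 0) (b 2) = -1

/-- The parametrization of the null lines in the span of a null frame, except for one. -/
noncomputable def conic (b : Fin 3 → R42) (t : ℝ) : R42 := b 0 + t • b 1 + (t ^ 2 / 2) • b 2

/-- The derivative of `conic b`. -/
noncomputable def conicDeriv (b : Fin 3 → R42) (t : ℝ) : R42 := b 1 + t • b 2

section Conic

variable {b : Fin 3 → R42}

lemma conic_mem_span (b : Fin 3 → R42) (t : ℝ) : conic b t ∈ span ℝ (Set.range b) :=
  add_mem (add_mem (subset_span ⟨0, rfl⟩) (smul_mem _ _ (subset_span ⟨1, rfl⟩)))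
    (smul_mem _ _ (subset_span ⟨2, rfl⟩))

lemma conicDeriv_mem_span (b : Fin 3 → R42) (t : ℝ) : conicDeriv b t ∈ span ℝ (Set.range b) :=
  add_mem (subset_span ⟨1, rfl⟩) (smul_mem _ _ (subset_span ⟨2, rfl⟩))

lemma hasDerivAt_conic (b : Fin 3 → R42) (t : ℝ) : HasDerivAt (conic b) (conicDeriv b t) t := by
  have h1 := (hasDerivAt_id t).smul_const (b 1)
  have h2 := (((hasDerivAt_id t).pow 2).div_const 2).smul_const (b 2)
  exact ((h1.const_add (b 0)).add h2).congr_deriv (by simp [conicDeriv])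

lemma contDiff_conic (b : Fin 3 → R42) : ContDiff ℝ ∞ (conic b) := by
  unfold conic
  fun_prop

namespace IsNullFrame

lemma form_conic_conic (hb : IsNullFrame b) (t : ℝ) : form (conic b t) (conic b t) = 0 := by
  simp only [conic, map_add, map_smul, LinearMap.add_apply, LinearMap.smul_apply, smul_eq_mul,
    hb.form_zero_zero, hb.form_one_one, hb.form_two_two, hb.form_zero_one, hb.form_one_two,
    hb.form_zero_two, form_comm (b 1) (b 0), form_comm (b 2) (b 1), form_comm (b 2) (b 0)]
  ring

lemma form_conic_conicDeriv (hb : IsNullFrame b) (t : ℝ) :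
    form (conic b t) (conicDeriv b t) = 0 := by
  simp only [conic, conicDeriv, map_add, map_smul, LinearMap.add_apply, LinearMap.smul_apply,
    smul_eq_mul, hb.form_one_one, hb.form_two_two, hb.form_zero_one, hb.form_one_two,
    hb.form_zero_two, form_comm (b 2) (b 1)]
  ring

lemma form_conicDeriv_conicDeriv (hb : IsNullFrame b) (t : ℝ) :
    form (conicDeriv b t) (conicDeriv b t) = 1 := by
  simp only [conicDeriv, map_add, map_smul, LinearMap.add_apply, LinearMap.smul_apply,
    smul_eq_mul, hb.form_one_one, hb.form_two_two, hb.form_one_two, form_comm (b 2) (b 1)]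
  ring

lemma form_conic_two (hb : IsNullFrame b) (t : ℝ) : form (conic b t) (b 2) = -1 := by
  simp only [conic, map_add, map_smul, LinearMap.add_apply, LinearMap.smul_apply, smul_eq_mul,
    hb.form_two_two, hb.form_one_two, hb.form_zero_two]
  ring

lemma conic_ne_zero (hb : IsNullFrame b) (t : ℝ) : conic b t ≠ 0 := fun h => by
  have := hb.form_conic_two t
  simp [h] at this

lemma linearIndependent (hb : IsNullFrame b) : LinearIndependent ℝ b := by
  rw [Fintype.linearIndependent_iff]
  intro c hc
  rw [Fin.sum_univ_three] at hc
  have h0 := congrArg (form (b 0)) hc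
  have h1 := congrArg (form (b 1)) hc
  have h2 := congrArg (form (b 2)) hc
  simp only [map_add, map_smul, smul_eq_mul, map_zero,
    hb.form_zero_zero, hb.form_one_one, hb.form_two_two, hb.form_zero_one, hb.form_one_two,
    hb.form_zero_two, form_comm (b 1) (b 0), form_comm (b 2) (b 1), form_comm (b 2) (b 0)]
    at h0 h1 h2
  intro i
  fin_cases i
  · simpa using h2
  · simpa using h1
  · simpa using h0

/-- A null vector in the plane of a null frame is on its conic or a multiple of the last vector. -/
lemma eq_smul_conic (hb : IsNullFrame b) {x : R42} (hx : x ∈ span ℝ (Set.range b))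
    (hnull : form x x = 0) (h2 : form x (b 2) ≠ 0) :
    x = (-form x (b 2)) • conic b (form x (b 1) / (-form x (b 2))) := by
  obtain ⟨c, rfl⟩ := (mem_span_range_iff_exists_fun ℝ).1 hx
  simp only [Fin.sum_univ_three, map_add, map_smul, LinearMap.add_apply, LinearMap.smul_apply,
    smul_eq_mul, hb.form_zero_zero, hb.form_one_one, hb.form_two_two, hb.form_zero_one,
    hb.form_one_two, hb.form_zero_two, form_comm (b 1) (b 0), form_comm (b 2) (b 1),
    form_comm (b 2) (b 0)] at hnull h2 ⊢
  have h0 : c 0 ≠ 0 := by rintro h; simp [h] at h2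
  -- Nullity reads `c₁² = 2 c₀ c₂`.
  have h3 : c 2 = c 0 * ((c 1 / c 0) ^ 2 / 2) := by
    field_simp
    linarith
  have h4 : c 1 = c 0 * (c 1 / c 0) := by field_simp
  simp only [mul_zero, add_zero, zero_add, mul_neg, mul_one, neg_neg, conic, smul_add, smul_smul]
  rw [← h3, ← h4]

lemma map_lieInversion (hb : IsNullFrame b) {a : R42} (ha : form a a ≠ 0) :
    IsNullFrame fun i => lieInversion a (b i) := by
  constructor <;> simp only [form_lieInversion ha]
  exacts [hb.1, hb.2, hb.3, hb.4, hb.5, hb.6]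

end IsNullFrame

lemma lieInversion_conic (a : R42) (t : ℝ) :
    lieInversion a (conic b t) = conic (fun i => lieInversion a (b i)) t := by
  simp [conic]

/-- Three distinct parameters suffice: first and second divided differences of the quadratic `conic
b` recover `b 2`, then `b 1`, then `b 0`. -/
lemma span_conic_image {S : Set ℝ} (hS : S.Infinite) :
    span ℝ (Set.range b) ≤ span ℝ (conic b '' S) := by
  obtain ⟨x, hx⟩ := hS.nonempty
  have hS1 : (S \ {x}).Infinite := hS.sdiff (Set.finite_singleton x)
  obtain ⟨y, hy, hyx⟩ := hS1.nonempty
  obtain ⟨z, ⟨hz, hzx⟩, hzy⟩ := (hS1.sdiff (Set.finite_singleton y)).nonempty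
  have hmem : ∀ t ∈ S, conic b t ∈ span ℝ (conic b '' S) := fun t ht => subset_span ⟨t, ht, rfl⟩
  have hyx' : y - x ≠ 0 := sub_ne_zero.2 hyx
  have hzx' : z - x ≠ 0 := sub_ne_zero.2 hzx
  have hzy' : z - y ≠ 0 := sub_ne_zero.2 hzy
  have hdd : ∀ t : ℝ, t - x ≠ 0 → (t - x)⁻¹ • (conic b t - conic b x) =
      b 1 + ((t + x) / 2) • b 2 := fun t ht => by
    rw [inv_smul_eq_iff₀ ht]
    simp only [conic]
    module
  have h1 : ∀ t ∈ S, t - x ≠ 0 → b 1 + ((t + x) / 2) • b 2 ∈ span ℝ (conic b '' S) :=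
    fun t ht h => hdd t h ▸ smul_mem _ _ (sub_mem (hmem t ht) (hmem x hx))
  have h2 : b 2 ∈ span ℝ (conic b '' S) := by
    have : b 2 = (2 * (z - y)⁻¹) •
        ((b 1 + ((z + x) / 2) • b 2) - (b 1 + ((y + x) / 2) • b 2)) := by
      have : (b 1 + ((z + x) / 2) • b 2) - (b 1 + ((y + x) / 2) • b 2) =
        ((z - y) / 2) • b 2 := by module
      rw [this, smul_smul]
      have : 2 * (z - y)⁻¹ * ((z - y) / 2) = 1 := by field_simp
      rw [this, one_smul]
    rw [this]
    exact smul_mem _ _ (sub_mem (h1 z hz hzx') (h1 y hy hyx'))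
  have h3 : b 1 ∈ span ℝ (conic b '' S) :=
    (add_mem_cancel_right (smul_mem _ _ h2)).1 (h1 y hy hyx')
  have h4 : b 0 ∈ span ℝ (conic b '' S) :=
    (add_mem_cancel_right (smul_mem _ _ h3)).1 ((add_mem_cancel_right (smul_mem _ _ h2)).1 (hmem x hx))
  rw [span_le]
  rintro _ ⟨i, rfl⟩
  fin_cases i
  exacts [h4, h3, h2]

lemma IsNullFrame.isNullFamily (hb : IsNullFrame b) {I : Type*} {k : I → ℝ}
    (hk : Function.Injective k) :
    IsNullFamily (span ℝ (Set.range b)) fun t => conic b (k t) where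
  mem t := conic_mem_span b _
  null t := hb.form_conic_conic _
  le_span S hS := by
    have := span_conic_image (b := b) (hS.image hk.injOn)
    rwa [Set.image_image] at this

end Conic

lemma IsPlane21.exists_nullFrame {D : Submodule ℝ R42} (hD : IsPlane21 D) {s : R42} (hs : s ∈ D)
    (hs0 : s ≠ 0) (hnull : form s s = 0) :
    ∃ b, IsNullFrame b ∧ span ℝ (Set.range b) = D ∧ b 0 = s := by
  have hrank := hD.finrank_eq
  obtain ⟨e, -, rfl, he⟩ := hD
  obtain ⟨c, rfl⟩ := (mem_span_range_iff_exists_fun ℝ).1 hs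
  rw [Fin.sum_univ_three] at hnull hs0
  simp [he] at hnull
  have hz : c 2 ≠ 0 := by
    intro h
    rw [h] at hnull
    have h0 : c 0 = 0 := by nlinarith [sq_nonneg (c 0), sq_nonneg (c 1)]
    have h1 : c 1 = 0 := by nlinarith [sq_nonneg (c 0), sq_nonneg (c 1)]
    simp [h, h0, h1] at hs0
  -- Nullity gives `c₀² + c₁² = c₂²`. The unit vector is the spatial part of `s` turned by a right
  -- angle and scaled; the second null vector is `s` with its spatial part reversed, scaled to have
  -- product `-1` with `s`.
  let b : Fin 3 → R42 := ![∑ i, c i • e i, (c 2)⁻¹ • (c 0 • e 1 - c 1 • e 0),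
    (2 * (c 2 * c 2))⁻¹ • (c 2 • e 2 - c 0 • e 0 - c 1 • e 1)]
  have hb : IsNullFrame b := by
    constructor <;> simp [b, Fin.sum_univ_three, he] <;> field_simp <;>
      first | linarith | (right; linarith)
  refine ⟨b, hb, eq_of_le_of_finrank_eq (span_le.2 ?_) ?_, rfl⟩
  · have hm : ∀ i, e i ∈ span ℝ (Set.range e) := fun i => subset_span ⟨i, rfl⟩
    rintro _ ⟨i, rfl⟩
    fin_cases i
    · exact hs
    · exact smul_mem _ _ (sub_mem (smul_mem _ _ (hm 1)) (smul_mem _ _ (hm 0)))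
    · exact smul_mem _ _ (sub_mem (sub_mem (smul_mem _ _ (hm 2)) (smul_mem _ _ (hm 0)))
        (smul_mem _ _ (hm 1)))
  · rw [finrank_span_eq_card hb.linearIndependent, hrank]
    rfl

lemma IsPlane21.exists_null {D : Submodule ℝ R42} (hD : IsPlane21 D) :
    ∃ s ∈ D, s ≠ 0 ∧ form s s = 0 := by
  obtain ⟨e, hli, rfl, he⟩ := hD
  refine ⟨e 0 + e 2, add_mem (subset_span ⟨0, rfl⟩) (subset_span ⟨2, rfl⟩), fun h => ?_, ?_⟩
  · have := congrArg (form (e 0)) h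
    simp [he] at this
  · simp [he]

/-! ### Legendre maps spanned by two conics. -/

/-- Over `W` the family `f` is spanned by the points of two conics in orthogonal planes with the
parameters `u 0` and `u 1`. -/
structure IsConicForm (f : ℝ × ℝ → Submodule ℝ R42) (W : Set (ℝ × ℝ)) (b : Fin 2 → Fin 3 → R42)
    (u : Fin 2 → ℝ × ℝ → ℝ) : Prop where
  isOpen : IsOpen W
  frame : ∀ i, IsNullFrame (b i)
  orthogonal : ∀ i j, i ≠ j → ∀ x ∈ span ℝ (Set.range (b i)), ∀ y ∈ span ℝ (Set.range (b j)),
    form x y = 0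
  smooth : ∀ i, ContDiffOn ℝ ∞ (u i) W
  eq_span : ∀ q ∈ W, f q = span ℝ (Set.range fun i => conic (b i) (u i q))

namespace IsConicForm

variable {f : ℝ × ℝ → Submodule ℝ R42} {W : Set (ℝ × ℝ)} {b : Fin 2 → Fin 3 → R42}
  {u : Fin 2 → ℝ × ℝ → ℝ} {q : ℝ × ℝ}

lemma mono (h : IsConicForm f W b u) {W' : Set (ℝ × ℝ)} (hW' : IsOpen W') (hle : W' ⊆ W) :
    IsConicForm f W' b u :=
  ⟨hW', h.frame, h.orthogonal, fun i => (h.smooth i).mono hle, fun q hq => h.eq_span q (hle hq)⟩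

lemma mem_iff (h : IsConicForm f W b u) (hq : q ∈ W) {x : R42} :
    x ∈ f q ↔ ∃ c : Fin 2 → ℝ, ∑ i, c i • conic (b i) (u i q) = x := by
  rw [h.eq_span q hq, mem_span_range_iff_exists_fun]

lemma conic_mem (h : IsConicForm f W b u) (hq : q ∈ W) (i : Fin 2) :
    conic (b i) (u i q) ∈ f q := by
  rw [h.eq_span q hq]
  exact subset_span ⟨i, rfl⟩

lemma form_eq_zero (h : IsConicForm f W b u) {i j : Fin 2} (hij : i ≠ j) {x y : R42}
    (hx : x ∈ span ℝ (Set.range (b i))) (hy : y ∈ span ℝ (Set.range (b j))) : form x y = 0 :=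
  h.orthogonal i j hij x hx y hy

lemma form_two_sum (h : IsConicForm f W b u) (c : Fin 2 → ℝ) (i : Fin 2) :
    form (b i 2) (∑ j, c j • conic (b j) (u j q)) = -c i := by
  rw [map_sum, Finset.sum_eq_single i]
  · rw [map_smul, form_comm, (h.frame i).form_conic_two, smul_eq_mul, mul_neg_one]
  · intro j _ hj
    rw [map_smul, h.form_eq_zero hj.symm (subset_span ⟨2, rfl⟩) (conic_mem_span _ _), smul_zero]
  · simp

lemma form_conic_conic (h : IsConicForm f W b u) (i j : Fin 2) :
    form (conic (b i) (u i q)) (conic (b j) (u j q)) = 0 := by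
  rcases eq_or_ne i j with rfl | hij
  · exact (h.frame i).form_conic_conic _
  · exact h.form_eq_zero hij (conic_mem_span _ _) (conic_mem_span _ _)

lemma form_conic_conicDeriv (h : IsConicForm f W b u) (i j : Fin 2) :
    form (conic (b i) (u i q)) (conicDeriv (b j) (u j q)) = 0 := by
  rcases eq_or_ne i j with rfl | hij
  · exact (h.frame i).form_conic_conicDeriv _
  · exact h.form_eq_zero hij (conic_mem_span _ _) (conicDeriv_mem_span _ _)

lemma form_conicDeriv_conicDeriv (h : IsConicForm f W b u) (i j : Fin 2) :
    form (conicDeriv (b i) (u i q)) (conicDeriv (b j) (u j q)) = if i = j then 1 else 0 := by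
  split_ifs with hij
  · rw [hij]
    exact (h.frame j).form_conicDeriv_conicDeriv _
  · exact h.form_eq_zero hij (conicDeriv_mem_span _ _) (conicDeriv_mem_span _ _)

lemma linearIndependent (h : IsConicForm f W b u) :
    LinearIndependent ℝ fun i => conic (b i) (u i q) := by
  rw [Fintype.linearIndependent_iff]
  intro c hc i
  have := h.form_two_sum (q := q) c i
  rw [hc, map_zero] at this
  linarith

lemma isContactElement (h : IsConicForm f W b u) (hq : q ∈ W) : IsContactElement (f q) := by
  constructor
  · rw [h.eq_span q hq, finrank_span_eq_card h.linearIndependent]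
    rfl
  · intro x hx y hy
    obtain ⟨c, rfl⟩ := (h.mem_iff hq).1 hx
    obtain ⟨d, rfl⟩ := (h.mem_iff hq).1 hy
    simp [h.form_conic_conic]

/-- The two vectors `conicDeriv` are orthonormal and orthogonal to the contact element, so pairing
with them reads off the coefficients `d`. -/
lemma sum_mem_iff (h : IsConicForm f W b u) (hq : q ∈ W) (c d : Fin 2 → ℝ) :
    ∑ i, (c i • conic (b i) (u i q) + d i • conicDeriv (b i) (u i q)) ∈ f q ↔ ∀ i, d i = 0 := by
  constructor
  · intro hmem i
    obtain ⟨e, he⟩ := (h.mem_iff hq).1 hmem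
    have := congrArg (fun x => form x (conicDeriv (b i) (u i q))) he
    simpa [h.form_conic_conicDeriv, h.form_conicDeriv_conicDeriv, -Fin.sum_univ_two] using this.symm
  · intro hd
    simp only [hd, zero_smul, add_zero]
    exact (h.mem_iff hq).2 ⟨c, rfl⟩

lemma differentiableAt (h : IsConicForm f W b u) (hq : q ∈ W) (i : Fin 2) :
    DifferentiableAt ℝ (u i) q :=
  ((h.smooth i).contDiffAt (h.isOpen.mem_nhds hq)).differentiableAt (by simp)

lemma hasFDerivAt_conic (h : IsConicForm f W b u) (hq : q ∈ W) (i : Fin 2) :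
    HasFDerivAt (fun q => conic (b i) (u i q))
      ((fderiv ℝ (u i) q).smulRight (conicDeriv (b i) (u i q))) q :=
  ((hasDerivAt_conic (b i) (u i q)).hasFDerivAt.comp q
    (h.differentiableAt hq i).hasFDerivAt).congr_fderiv (by ext <;> simp)

lemma isSmoothSectionAt_conic (h : IsConicForm f W b u) (hq : q ∈ W) (i : Fin 2) :
    IsSmoothSectionAt f q fun q => conic (b i) (u i q) :=
  ⟨W, h.isOpen, hq, (contDiff_conic (b i)).comp_contDiffOn (h.smooth i),
    fun _ hq' => h.conic_mem hq' i⟩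

/-- The product rule. The coefficients of a section are differentiable because pairing with `b i 2`
extracts them (`form_two_sum`); their derivatives contribute only inside the contact element. -/
lemma exists_fderiv_section (h : IsConicForm f W b u) (hq : q ∈ W) {s : ℝ × ℝ → R42}
    (hs : IsSmoothSectionAt f q s) (X : ℝ × ℝ) :
    ∃ c c' : Fin 2 → ℝ, s q = ∑ i, c i • conic (b i) (u i q) ∧
      fderiv ℝ s q X = ∑ i, (c' i • conic (b i) (u i q) +
        (c i * fderiv ℝ (u i) q X) • conicDeriv (b i) (u i q)) := by
  obtain ⟨V, hV, hqV, hsV, hsf⟩ := hs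
  have hsd : DifferentiableAt ℝ s q :=
    (hsV.contDiffAt (hV.mem_nhds hqV)).differentiableAt (by simp)
  let c : Fin 2 → ℝ × ℝ → ℝ := fun i q => -(form (b i 2)).toContinuousLinearMap (s q)
  have hc : ∀ i, DifferentiableAt ℝ (c i) q := fun i =>
    ((form (b i 2)).toContinuousLinearMap.differentiableAt.comp q hsd).neg
  have heq : ∀ q' ∈ W ∩ V, s q' = ∑ i, c i q' • conic (b i) (u i q') := by
    intro q' hq'
    obtain ⟨e, he⟩ := (h.mem_iff hq'.1).1 (hsf q' hq'.2)
    have : ∀ i, c i q' = e i := fun i => by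
      have := h.form_two_sum (q := q') e i
      rw [he] at this
      simp [c, this]
    simp only [this, he]
  have hder := HasFDerivAt.fun_sum (u := Finset.univ) fun i _ =>
    (hc i).hasFDerivAt.smul (h.hasFDerivAt_conic hq i)
  have hder' := hder.congr_of_eventuallyEq
    (Filter.eventually_of_mem ((h.isOpen.inter hV).mem_nhds ⟨hq, hqV⟩) heq)
  refine ⟨fun i => c i q, fun i => fderiv ℝ (c i) q X, heq q ⟨hq, hqV⟩, ?_⟩
  rw [hder'.fderiv]
  simp only [sum_apply, add_apply,
    _root_.smul_apply, ContinuousLinearMap.smulRight_apply, smul_smul]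
  exact Finset.sum_congr rfl fun i _ => add_comm _ _

lemma forall_section_iff (h : IsConicForm f W b u) (hq : q ∈ W) (X : ℝ × ℝ) :
    (∀ s, IsSmoothSectionAt f q s → fderiv ℝ s q X ∈ f q) ↔ ∀ i, fderiv ℝ (u i) q X = 0 := by
  constructor
  · intro hX i
    have h1 := hX _ (h.isSmoothSectionAt_conic hq i)
    rw [(h.hasFDerivAt_conic hq i).fderiv] at h1
    obtain ⟨e, he⟩ := (h.mem_iff hq).1 h1
    have := congrArg (fun x => form x (conicDeriv (b i) (u i q))) he
    simpa [h.form_conic_conicDeriv, h.form_conicDeriv_conicDeriv] using this.symm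
  · intro hX s hs
    obtain ⟨c, c', -, h1⟩ := h.exists_fderiv_section hq hs X
    rw [h1]
    exact (h.sum_mem_iff hq _ _).2 fun i => by rw [hX, mul_zero]

/-- Modulo `f q` the derivative of a section has components `c i * du i(X)`. They all vanish for
some nonzero `c` exactly when some `du i(X)` is zero, and then the `i`-th conic point is a curvature
sphere. -/
lemma isCurvatureDirection_iff (h : IsConicForm f W b u) (hq : q ∈ W) (X : ℝ × ℝ) :
    IsCurvatureDirection f q X ↔ X ≠ 0 ∧ ∃ i, fderiv ℝ (u i) q X = 0 := by
  refine and_congr_right fun _ => ⟨?_, ?_⟩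
  · rintro ⟨s, hs, hs0, hX⟩
    obtain ⟨c, c', h1, h2⟩ := h.exists_fderiv_section hq hs X
    rw [h2, h.sum_mem_iff hq] at hX
    by_contra! hne
    refine hs0 (h1.trans (Finset.sum_eq_zero fun i _ => ?_))
    rw [(mul_eq_zero.1 (hX i)).resolve_right (hne i), zero_smul]
  · rintro ⟨i, hi⟩
    refine ⟨_, h.isSmoothSectionAt_conic hq i, (h.frame i).conic_ne_zero _, ?_⟩
    rw [(h.hasFDerivAt_conic hq i).fderiv, ContinuousLinearMap.smulRight_apply, hi, zero_smul]
    exact zero_mem _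

lemma isLegendreMap (h : IsConicForm f W b u)
    (hu : ∀ p ∈ W, ∀ X, (∀ i, fderiv ℝ (u i) p X = 0) → X = 0) : IsLegendreMap W f where
  contactElement _ hp := h.isContactElement hp
  smooth p hp := ⟨W, _, _, h.isOpen, hp, (contDiff_conic (b 0)).comp_contDiffOn (h.smooth 0),
    (contDiff_conic (b 1)).comp_contDiffOn (h.smooth 1), fun q hq => by
      rw [h.eq_span q hq]
      congr 1
      ext x
      simp [eq_comm]⟩
  contact p hp s t hs ht X := by
    obtain ⟨c, c', h1, -⟩ := h.exists_fderiv_section hp hs X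
    obtain ⟨d, d', -, h2⟩ := h.exists_fderiv_section hp ht X
    rw [h1, h2]
    simp [h.form_conic_conic, h.form_conic_conicDeriv]
  immersion p hp X hX := hu p hp X ((h.forall_section_iff hp X).1 hX)

end IsConicForm

/-- Membership in `contactElements` gives the curvature spheres only pointwise; their smooth
dependence has to be extracted from a smooth local frame of `f`. -/
lemma IsLegendreMap.exists_isConicForm {U : Set (ℝ × ℝ)} {f : ℝ × ℝ → Submodule ℝ R42}
    (hf : IsLegendreMap U f) (hU : IsOpen U) {Δ : DupinCyclide}
    (hΔ : ∀ p ∈ U, f p ∈ Δ.contactElements) {p : ℝ × ℝ} (hp : p ∈ U) :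
    ∃ W ⊆ U, p ∈ W ∧ ∃ b u, IsConicForm f W b u ∧
      ∀ i, span ℝ (Set.range (b i)) = Δ.plane i := by
  obtain ⟨s₀, hs₀, hfp⟩ := hΔ p hp
  choose b hb hbΔ hb0 using fun i =>
    (Δ.isPlane21 i).exists_nullFrame (hs₀ i).1 (hs₀ i).2.1 (hs₀ i).2.2
  obtain ⟨V, S, T, hV, hpV, hS, hT, hST⟩ := hf.smooth p hp
  have hmem : ∀ i, b i 0 ∈ span ℝ {S p, T p} := fun i => by
    rw [← hST p hpV, hfp, hb0]
    exact subset_span ⟨i, rfl⟩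
  choose c d hcd using fun i => mem_span_pair.1 (hmem i)
  -- A smooth section with constant coefficients that equals the curvature sphere `b i 0` at `p`.
  let R : Fin 2 → ℝ × ℝ → R42 := fun i q => c i • S q + d i • T q
  have hR : ∀ i, ContDiffOn ℝ ∞ (R i) V := fun i => (hS.const_smul _).add (hT.const_smul _)
  let ℓ : Fin 2 → Fin 3 → ℝ × ℝ → ℝ := fun i k q => (form (b i k)).toContinuousLinearMap (R i q)
  have hℓ : ∀ i k, ContDiffOn ℝ ∞ (ℓ i k) V := fun i k =>
    (form (b i k)).toContinuousLinearMap.contDiff.comp_contDiffOn (hR i)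
  have hopen : ∀ i, IsOpen (V ∩ ℓ i 2 ⁻¹' {0}ᶜ) := fun i =>
    (hℓ i 2).continuousOn.isOpen_inter_preimage hV isOpen_compl_singleton
  have hℓp : ∀ i, ℓ i 2 p ≠ 0 := fun i => by
    simp only [ℓ, R, hcd, LinearMap.coe_toContinuousLinearMap']
    rw [form_comm, (hb i).form_zero_two]
    norm_num
  refine ⟨U ∩ ((V ∩ ℓ 0 2 ⁻¹' {0}ᶜ) ∩ (V ∩ ℓ 1 2 ⁻¹' {0}ᶜ)), Set.inter_subset_left,
    ⟨hp, ⟨hpV, hℓp 0⟩, hpV, hℓp 1⟩, b, fun i q => ℓ i 1 q / (-ℓ i 2 q), ⟨hU.inter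
      ((hopen 0).inter (hopen 1)), hb, fun i j hij x hx y hy => ?_, fun i => ?_, ?_⟩, hbΔ⟩
  · rw [hbΔ] at hx hy
    exact Δ.form_eq_zero hij hx hy
  · refine ((hℓ i 1).mono fun q hq => hq.2.1.1).div ((hℓ i 2).mono fun q hq => hq.2.1.1).neg ?_
    intro q hq
    rw [neg_ne_zero]
    fin_cases i
    exacts [hq.2.1.2, hq.2.2.2]
  · rintro q ⟨hqU, ⟨hqV, hq0⟩, -, hq1⟩
    have hq : ∀ i, ℓ i 2 q ≠ 0 := by
      intro i
      fin_cases i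
      exacts [hq0, hq1]
    obtain ⟨s, hs, hfq⟩ := hΔ q hqU
    have hRmem : ∀ i, R i q ∈ f q := fun i => by
      rw [hST q hqV]
      exact mem_span_pair.2 ⟨c i, d i, rfl⟩
    -- Pairing with `plane i` sees only the component of `R i q` there, a multiple of the curvature
    -- sphere `s i`. The unknown factor `κ` cancels in the quotient defining the parameter.
    have hκ : ∀ i, ∃ κ : ℝ, ∀ k, ℓ i k q = κ * form (s i) (b i k) := by
      intro i
      have := hRmem i
      rw [hfq] at this
      obtain ⟨e, he⟩ := (mem_span_range_iff_exists_fun ℝ).1 this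
      refine ⟨e i, fun k => ?_⟩
      have hbk : b i k ∈ Δ.plane i := by
        rw [← hbΔ]
        exact subset_span ⟨k, rfl⟩
      simp only [ℓ, LinearMap.coe_toContinuousLinearMap']
      rw [← he, map_sum, Finset.sum_eq_single i]
      · rw [map_smul, form_comm, smul_eq_mul]
      · intro j _ hj
        rw [map_smul, Δ.form_eq_zero hj.symm hbk (hs j).1, smul_zero]
      · simp
    have key : ∀ i, ∃ μ : ℝ, μ ≠ 0 ∧ s i = μ • conic (b i) (ℓ i 1 q / (-ℓ i 2 q)) := by
      intro i
      obtain ⟨κ, hκ⟩ := hκ i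
      have h2 := hq i
      rw [hκ] at h2
      have hκ0 := left_ne_zero_of_mul h2
      have hf0 := right_ne_zero_of_mul h2
      refine ⟨-form (s i) (b i 2), neg_ne_zero.2 hf0, ?_⟩
      rw [hκ, hκ, ← mul_neg, mul_div_mul_left _ _ hκ0]
      exact (hb i).eq_smul_conic (by rw [hbΔ]; exact (hs i).1) (hs i).2.2 hf0
    choose μ hμ hsμ using key
    rw [hfq]
    refine le_antisymm (span_le.2 ?_) (span_le.2 ?_)
    · rintro _ ⟨i, rfl⟩
      rw [SetLike.mem_coe, hsμ]
      exact smul_mem _ _ (subset_span ⟨i, rfl⟩)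
    · rintro _ ⟨i, rfl⟩
      have : conic (b i) (ℓ i 1 q / (-ℓ i 2 q)) = (μ i)⁻¹ • s i := by
        rw [hsμ i, smul_smul, inv_mul_cancel₀ (hμ i), one_smul]
      rw [SetLike.mem_coe]
      simp only [this]
      exact smul_mem _ _ (subset_span ⟨i, rfl⟩)

/-! ### Adapted coordinates and separation of variables. -/

section Coordinates

lemma exists_local_inverse {φ : ℝ × ℝ → ℝ × ℝ} {p : ℝ × ℝ} {W : Set (ℝ × ℝ)}
    (hW : W ∈ nhds p) (hφ : ContDiffAt ℝ 1 φ p) (hinj : Function.Injective (fderiv ℝ φ p)) :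
    ∃ (B : Set (ℝ × ℝ)) (g : ℝ × ℝ → ℝ × ℝ), IsOpen B ∧ φ p ∈ B ∧ ContDiffOn ℝ 1 g B ∧
      ∀ z ∈ B, g z ∈ W ∧ φ (g z) = z := by
  let e : (ℝ × ℝ) ≃L[ℝ] ℝ × ℝ :=
    (LinearEquiv.ofInjectiveEndo (fderiv ℝ φ p : ℝ × ℝ →ₗ[ℝ] ℝ × ℝ) hinj).toContinuousLinearEquiv
  have he : HasFDerivAt φ (e : ℝ × ℝ →L[ℝ] ℝ × ℝ) p :=
    (hφ.differentiableAt (by simp)).hasFDerivAt.congr_fderiv (by ext <;> rfl)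
  have hstrict := hφ.hasStrictFDerivAt' he one_ne_zero
  have hg : ContDiffAt ℝ 1 (hφ.localInverse he one_ne_zero) (φ p) :=
    hφ.to_localInverse he one_ne_zero
  have hgp : hφ.localInverse he one_ne_zero (φ p) = p :=
    hφ.localInverse_apply_image he one_ne_zero
  have h1 := hg.eventually (by simp)
  have h2 := hstrict.eventually_right_inverse
  have h3 := hg.continuousAt.preimage_mem_nhds (t := W) (by rwa [hgp])
  obtain ⟨B, hB, hBo, hpB⟩ := mem_nhds_iff.1 (h1.and (h2.and h3))
  exact ⟨B, _, hBo, hpB, fun z hz => (hB hz).1.contDiffWithinAt,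
    fun z hz => ⟨(hB hz).2.2, (hB hz).2.1⟩⟩

lemma exists_perm_of_ne : ∀ i j : Fin 2, i ≠ j →
    (∃ τ : Equiv.Perm (Fin 2), τ 0 = i ∧ τ 1 = j) ∧ ∀ k, k = i ∨ k = j := by
  decide

/-- If at each point each coordinate vector is in the kernel of some `d(h i)`, then near a point
where `dh` is injective, each `h i` depends on one coordinate only. -/
lemma exists_perm_fderiv {h : Fin 2 → ℝ × ℝ → ℝ} {B : Set (ℝ × ℝ)} (hB : IsOpen B) {z₀ : ℝ × ℝ}
    (hz₀ : z₀ ∈ B) (hh : ∀ i, ContDiffOn ℝ 1 (h i) B)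
    (hdir : ∀ z ∈ B, ∀ v ∈ ({(1, 0), (0, 1)} : Set (ℝ × ℝ)), ∃ i, fderiv ℝ (h i) z v = 0)
    (hinj : ∀ X, (∀ i, fderiv ℝ (h i) z₀ X = 0) → X = 0) :
    ∃ τ : Equiv.Perm (Fin 2), ∃ ε > 0, Metric.ball z₀ ε ⊆ B ∧ ∀ z ∈ Metric.ball z₀ ε,
      (fderiv ℝ (h (τ 0)) z (0, 1) = 0 ∧ fderiv ℝ (h (τ 0)) z (1, 0) ≠ 0) ∧
      (fderiv ℝ (h (τ 1)) z (1, 0) = 0 ∧ fderiv ℝ (h (τ 1)) z (0, 1) ≠ 0) := by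
  obtain ⟨i₁, hi₁⟩ := hdir z₀ hz₀ (1, 0) (by simp)
  obtain ⟨i₀, hi₀⟩ := hdir z₀ hz₀ (0, 1) (by simp)
  have hne : i₀ ≠ i₁ := by
    rintro rfl
    have hlin : ∀ i (x y : ℝ), fderiv ℝ (h i) z₀ (x, y) =
        x * fderiv ℝ (h i) z₀ (1, 0) + y * fderiv ℝ (h i) z₀ (0, 1) := fun i x y => by
      have : ((x, y) : ℝ × ℝ) = x • (1, 0) + y • (0, 1) := by simp
      rw [this, map_add, map_smul, map_smul, smul_eq_mul, smul_eq_mul]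
    obtain ⟨i, hi⟩ : ∃ i : Fin 2, ∀ j, j = i₀ ∨ j = i :=
      ⟨i₀ + 1, fun j => (exists_perm_of_ne i₀ (i₀ + 1) (by simp)).2 j⟩
    -- If one differential kills both coordinate vectors, the other still has this kernel vector.
    -- Its vanishing makes the other differential zero too, contradicting injectivity.
    have hX := hinj (fderiv ℝ (h i) z₀ (0, 1), -fderiv ℝ (h i) z₀ (1, 0)) fun j => by
      rw [hlin]
      rcases hi j with rfl | rfl
      · rw [hi₀, hi₁]
        ring
      · ring
    have h10 := hinj (1, 0) fun j => by
      rcases hi j with rfl | rfl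
      · exact hi₁
      · simpa using congrArg Prod.snd hX
    simpa using congrArg Prod.fst h10
  obtain ⟨⟨τ, hτ0, hτ1⟩, hcover⟩ := exists_perm_of_ne i₀ i₁ hne
  have hn₀ : fderiv ℝ (h i₀) z₀ (1, 0) ≠ 0 := fun h0 => by
    have := hinj (1, 0) fun j => by rcases hcover j with rfl | rfl <;> assumption
    simpa using congrArg Prod.fst this
  have hn₁ : fderiv ℝ (h i₁) z₀ (0, 1) ≠ 0 := fun h0 => by
    have := hinj (0, 1) fun j => by rcases hcover j with rfl | rfl <;> assumption
    simpa using congrArg Prod.snd this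
  have hcont : ∀ i (v : ℝ × ℝ), ContinuousAt (fun z => fderiv ℝ (h i) z v) z₀ := fun i v =>
    (((hh i).continuousOn_fderiv_of_isOpen hB le_rfl).continuousAt
      (hB.mem_nhds hz₀)).clm_apply continuousAt_const
  obtain ⟨ε, hε, hball⟩ := Metric.mem_nhds_iff.1 (Filter.inter_mem (hB.mem_nhds hz₀)
    (((hcont i₀ (1, 0)).eventually_ne hn₀).and ((hcont i₁ (0, 1)).eventually_ne hn₁)))
  refine ⟨τ, ε, hε, fun z hz => (hball hz).1, fun z hz => ?_⟩
  obtain ⟨hzB, h0, h1⟩ := hball hz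
  rw [hτ0, hτ1]
  refine ⟨⟨?_, h0⟩, ?_, h1⟩
  · obtain ⟨i, hi⟩ := hdir z hzB (0, 1) (by simp)
    rcases hcover i with rfl | rfl
    · exact hi
    · exact absurd hi h1
  · obtain ⟨i, hi⟩ := hdir z hzB (1, 0) (by simp)
    rcases hcover i with rfl | rfl
    · exact absurd hi h0
    · exact hi

/-- Mean value theorem along a direction `v`: a vanishing partial derivative gives constancy, a
nonvanishing one injectivity. -/
lemma exists_sub_eq_mul_fderiv {h : ℝ × ℝ → ℝ} {z₀ : ℝ × ℝ} {ε : ℝ}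
    (hh : ContDiffOn ℝ 1 h (Metric.ball z₀ ε)) {x y : ℝ × ℝ} (hx : x ∈ Metric.ball z₀ ε)
    (hy : y ∈ Metric.ball z₀ ε) {c : ℝ} {v : ℝ × ℝ} (hxy : y - x = c • v) :
    ∃ z ∈ Metric.ball z₀ ε, h y - h x = c * fderiv ℝ h z v := by
  obtain ⟨z, hz, hzxy⟩ := domain_mvt (f' := fderiv ℝ h) (fun w hw =>
    ((hh.contDiffAt (Metric.isOpen_ball.mem_nhds hw)).differentiableAt
      (by simp)).hasFDerivAt.hasFDerivWithinAt) (convex_ball z₀ ε) hx hy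
  refine ⟨z, (convex_ball z₀ ε).segment_subset hx hy hz, ?_⟩
  rw [hzxy, hxy, map_smul, smul_eq_mul]

end Coordinates

/-! ### From a Ribaucour pair to a Lie inversion. -/

lemma DupinCyclide.exists_lieInversion_of_conicForm {Δ Δ' : DupinCyclide}
    {f f' : ℝ × ℝ → Submodule ℝ R42} {W : Set (ℝ × ℝ)} {b b' : Fin 2 → Fin 3 → R42}
    {u u' : Fin 2 → ℝ × ℝ → ℝ} (hf : IsConicForm f W b u) (hf' : IsConicForm f' W b' u')
    (hb : ∀ i, span ℝ (Set.range (b i)) = Δ.plane i)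
    (hb' : ∀ i, span ℝ (Set.range (b' i)) = Δ'.plane i) {p : ℝ × ℝ} (hp : p ∈ W)
    (hrib : IsRibaucourPair W f f') :
    ∃ τ : Equiv.Perm (Fin 2), ∃ σ, IsLieInversion σ ∧
      ∀ i, Δ'.plane (τ i) = (Δ.plane i).map σ := by
  have himm : ∀ q ∈ W, ∀ X, (∀ i, fderiv ℝ (u i) q X = 0) → X = 0 := fun q hq X hX =>
    hrib.legendre_left.immersion q hq X ((hf.forall_section_iff hq X).2 hX)
  have himm' : ∀ q ∈ W, ∀ X, (∀ i, fderiv ℝ (u' i) q X = 0) → X = 0 := fun q hq X hX =>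
    hrib.legendre_right.immersion q hq X ((hf'.forall_section_iff hq X).2 hX)
  have hcurv : ∀ q ∈ W, ∀ X ≠ 0, ∀ i, fderiv ℝ (u i) q X = 0 →
      ∃ j, fderiv ℝ (u' j) q X = 0 := fun q hq X hX i hi =>
    ((hf'.isCurvatureDirection_iff hq X).1 ((hrib.curvature q hq X).1
      ((hf.isCurvatureDirection_iff hq X).2 ⟨hX, i, hi⟩))).2
  let φ : ℝ × ℝ → ℝ × ℝ := fun q => (u 0 q, u 1 q)
  have hφ : ContDiffAt ℝ 1 φ p :=
    (((hf.smooth 0).prodMk (hf.smooth 1)).contDiffAt (hf.isOpen.mem_nhds hp)).of_le (by simp)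
  have hφd : ∀ q ∈ W, HasFDerivAt φ ((fderiv ℝ (u 0) q).prod (fderiv ℝ (u 1) q)) q :=
    fun q hq => (hf.differentiableAt hq 0).hasFDerivAt.prodMk
      (hf.differentiableAt hq 1).hasFDerivAt
  obtain ⟨B, g, hB, hpB, hg, hgB⟩ := exists_local_inverse (hf.isOpen.mem_nhds hp) hφ (by
    rw [(hφd p hp).fderiv, injective_iff_map_eq_zero]
    intro X hX
    refine himm p hp X fun i => ?_
    fin_cases i
    exacts [congrArg Prod.fst hX, congrArg Prod.snd hX])
  have hgd : ∀ z ∈ B, DifferentiableAt ℝ g z := fun z hz =>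
    (hg.contDiffAt (hB.mem_nhds hz)).differentiableAt (by simp)
  have hright : ∀ z ∈ B, ∀ X, (fderiv ℝ (u 0) (g z) (fderiv ℝ g z X),
      fderiv ℝ (u 1) (g z) (fderiv ℝ g z X)) = X := fun z hz X => by
    have h1 := (hφd (g z) (hgB z hz).1).comp z (hgd z hz).hasFDerivAt
    have h2 : HasFDerivAt (φ ∘ g) (ContinuousLinearMap.id ℝ (ℝ × ℝ)) z :=
      (hasFDerivAt_id z).congr_of_eventuallyEq
        (Filter.eventually_of_mem (hB.mem_nhds hz) fun w hw => (hgB w hw).2)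
    exact congrArg (fun L : ℝ × ℝ →L[ℝ] ℝ × ℝ => L X) (h1.unique h2)
  have hgne : ∀ z ∈ B, ∀ X, fderiv ℝ g z X = 0 → X = 0 := fun z hz X hX => by
    rw [← hright z hz X, hX]
    simp
  let h : Fin 2 → ℝ × ℝ → ℝ := fun i z => u' i (g z)
  have hh : ∀ i, ContDiffOn ℝ 1 (h i) B := fun i =>
    ((hf'.smooth i).of_le (by simp)).comp hg fun z hz => (hgB z hz).1
  have hhd : ∀ z ∈ B, ∀ i X, fderiv ℝ (h i) z X = fderiv ℝ (u' i) (g z) (fderiv ℝ g z X) :=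
    fun z hz i X => by
      have := ((hf'.differentiableAt (hgB z hz).1 i).hasFDerivAt.comp z
        (hgd z hz).hasFDerivAt).fderiv
      exact congrArg (fun L : ℝ × ℝ →L[ℝ] ℝ => L X) this
  obtain ⟨τ, ε, hε, hball, hτ⟩ := exists_perm_fderiv hB hpB hh (fun z hz v hv => by
      simp only [hhd z hz]
      have hr := hright z hz v
      -- Along the first coordinate vector `u 1` is stationary, along the second `u 0`.
      refine hcurv _ (hgB z hz).1 _ (fun h0 => ?_) (if v = (1, 0) then 1 else 0) ?_
      · have := hgne z hz v h0
        rcases hv with rfl | rfl <;> simp at this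
      · rcases hv with rfl | rfl
        · simpa using congrArg Prod.snd hr
        · simpa using congrArg Prod.fst hr)
    (fun X hX => hgne _ hpB X (himm' _ (hgB _ hpB).1 _ fun i => by rw [← hhd _ hpB, hX]))
  refine ⟨τ, ?_⟩
  have hhε := fun i => (hh i).mono hball
  have hmem : ∀ t u : Set.Ioo (-ε) ε, φ p + ((t : ℝ), (u : ℝ)) ∈ Metric.ball (φ p) ε :=
    fun t u => by
      rw [mem_ball_iff_norm, add_sub_cancel_left, Prod.norm_def, max_lt_iff]
      exact ⟨abs_lt.2 t.2, abs_lt.2 u.2⟩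
  let o : Set.Ioo (-ε) ε := ⟨0, neg_lt_zero.2 hε, hε⟩
  have : Infinite (Set.Ioo (-ε) ε) := (Set.Ioo_infinite (by linarith)).to_subtype
  -- The parameters of the second map on the coordinate axes through `φ p`; `hk0` and `hk1` show
  -- that they determine them on the whole square.
  let k : Fin 2 → Set.Ioo (-ε) ε → ℝ :=
    ![fun t => h (τ 0) (φ p + ((t : ℝ), ((o : ℝ)))), fun t => h (τ 1) (φ p + ((o : ℝ), (t : ℝ)))]
  let l : Fin 2 → Set.Ioo (-ε) ε → ℝ := ![fun t => (φ p).1 + t, fun t => (φ p).2 + t]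
  have hl : ∀ i, Function.Injective (l i) := by
    intro i x y hxy
    fin_cases i <;> exact Subtype.ext (by simpa [l] using hxy)
  have hk : ∀ i, Function.Injective (k i) := by
    intro i x y hxy
    fin_cases i
    · obtain ⟨z, hz, hz'⟩ := exists_sub_eq_mul_fderiv (hhε (τ 0)) (hmem x o) (hmem y o)
        (c := (y : ℝ) - x) (v := (1, 0)) (by simp)
      have : ((y : ℝ) - x) * fderiv ℝ (h (τ 0)) z (1, 0) = 0 := hz' ▸ sub_eq_zero.2 hxy.symm
      exact Subtype.ext (sub_eq_zero.1 ((mul_eq_zero.1 this).resolve_right (hτ z hz).1.2)).symm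
    · obtain ⟨z, hz, hz'⟩ := exists_sub_eq_mul_fderiv (hhε (τ 1)) (hmem o x) (hmem o y)
        (c := (y : ℝ) - x) (v := (0, 1)) (by simp)
      have : ((y : ℝ) - x) * fderiv ℝ (h (τ 1)) z (0, 1) = 0 := hz' ▸ sub_eq_zero.2 hxy.symm
      exact Subtype.ext (sub_eq_zero.1 ((mul_eq_zero.1 this).resolve_right (hτ z hz).2.2)).symm
  have hk0 : ∀ t u : Set.Ioo (-ε) ε, h (τ 0) (φ p + ((t : ℝ), (u : ℝ))) = k 0 t := fun t u => by
    obtain ⟨z, hz, hz'⟩ := exists_sub_eq_mul_fderiv (hhε (τ 0)) (hmem t o) (hmem t u)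
      (c := (u : ℝ) - o) (v := (0, 1)) (by simp)
    rw [(hτ z hz).1.1, mul_zero] at hz'
    exact sub_eq_zero.1 hz'
  have hk1 : ∀ t u : Set.Ioo (-ε) ε, h (τ 1) (φ p + ((t : ℝ), (u : ℝ))) = k 1 u := fun t u => by
    obtain ⟨z, hz, hz'⟩ := exists_sub_eq_mul_fderiv (hhε (τ 1)) (hmem o u) (hmem t u)
      (c := (t : ℝ) - o) (v := (1, 0)) (by simp)
    rw [(hτ z hz).2.1, mul_zero] at hz'
    exact sub_eq_zero.1 hz'
  refine exists_lieInversion (Δ' := Δ'.relabel τ) (s := fun i t => conic (b i) (l i t))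
    (s' := fun i t => conic (b' (τ i)) (k i t))
    (fun i => hb i ▸ (hf.frame i).isNullFamily (hl i))
    (fun i => hb' (τ i) ▸ (hf'.frame (τ i)).isNullFamily (hk i)) fun t v h0 => ?_
  obtain ⟨hqW, hq⟩ := hgB _ (hball (hmem t v))
  set q := g (φ p + ((t : ℝ), (v : ℝ))) with hqdef
  have hrank := hrib.common_sphere q hqW
  have hpair : ∀ (c : Fin 2 → R42), Set.range c = {c 0, c 1} := fun c => by
    ext x
    simp [eq_comm]
  have h1 : f q = span ℝ {conic (b 0) (l 0 t), conic (b 1) (l 1 v)} := by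
    rw [hf.eq_span q hqW, hpair]
    have e0 : u 0 q = l 0 t := congrArg Prod.fst hq
    have e1 : u 1 q = l 1 v := congrArg Prod.snd hq
    simp only [e0, e1]
  have h2 : f' q = span ℝ {conic (b' (τ 0)) (k 0 t), conic (b' (τ 1)) (k 1 v)} := by
    rw [hf'.eq_span q hqW, ← hk0 t v, ← hk1 t v, ← hpair fun i => conic (b' (τ i)) (u' (τ i) q),
      ← τ.surjective.range_comp]
    rfl
  rw [h1, h2, h0, finrank_bot] at hrank
  omega

lemma IsLegendreMap.mono {U W : Set (ℝ × ℝ)} {f : ℝ × ℝ → Submodule ℝ R42}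
    (h : IsLegendreMap U f) (hW : W ⊆ U) : IsLegendreMap W f :=
  ⟨fun p hp => h.1 p (hW hp), fun p hp => h.2 p (hW hp), fun p hp => h.3 p (hW hp),
    fun p hp => h.4 p (hW hp)⟩

lemma IsRibaucourPair.mono {U W : Set (ℝ × ℝ)} {f f' : ℝ × ℝ → Submodule ℝ R42}
    (h : IsRibaucourPair U f f') (hW : W ⊆ U) : IsRibaucourPair W f f' :=
  ⟨h.1.mono hW, h.2.mono hW, fun p hp => h.3 p (hW hp), fun p hp => h.4 p (hW hp)⟩

namespace DupinCyclide

variable {Δ Δ' : DupinCyclide}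

lemma RibaucourRelated.exists_lieInversion (h : Δ.RibaucourRelated Δ') :
    ∃ τ : Equiv.Perm (Fin 2), ∃ σ, IsLieInversion σ ∧
      ∀ i, Δ'.plane (τ i) = (Δ.plane i).map σ := by
  obtain ⟨U, f, f', hU, ⟨⟨p, hp⟩, -⟩, hf, hf', hrib⟩ := h
  obtain ⟨W, hWU, hpW, b, u, hb, hbΔ⟩ := hrib.legendre_left.exists_isConicForm hU hf hp
  obtain ⟨W', -, hpW', b', u', hb', hbΔ'⟩ := hrib.legendre_right.exists_isConicForm hU hf' hp
  have hW := hb.isOpen.inter hb'.isOpen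
  exact exists_lieInversion_of_conicForm (hb.mono hW Set.inter_subset_left)
    (hb'.mono hW Set.inter_subset_right) hbΔ hbΔ' ⟨hpW, hpW'⟩
    (hrib.mono fun q hq => hWU hq.1)

end DupinCyclide

/-! ### From a Lie inversion to a Ribaucour pair. -/

/-- The two coordinates of `ℝ × ℝ`, indexed by `Fin 2`. -/
noncomputable def coord (i : Fin 2) : ℝ × ℝ →L[ℝ] ℝ :=
  ![ContinuousLinearMap.fst ℝ ℝ ℝ, ContinuousLinearMap.snd ℝ ℝ ℝ] i

lemma eq_zero_of_fderiv_coord {p X : ℝ × ℝ} (h : ∀ i, fderiv ℝ (coord i) p X = 0) : X = 0 := by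
  simp only [ContinuousLinearMap.fderiv] at h
  exact Prod.ext (h 0) (h 1)

/-- A contact element not orthogonal to `a` and its image under the inversion in `a` have exactly
one sphere in common. -/
lemma finrank_inf_map_lieInversion {a : R42} (ha : form a a ≠ 0) {c : Submodule ℝ R42}
    (hc : IsContactElement c) {x : R42} (hx : x ∈ c) (hxa : form x a ≠ 0) :
    finrank ℝ (c ⊓ c.map (lieInversion a) : Submodule ℝ R42) = 1 := by
  have hle : c ⊓ c.map (lieInversion a) = c ⊓ LinearMap.ker (form a) := by
    ext y
    simp only [mem_inf, LinearMap.mem_ker, mem_map]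
    refine and_congr_right fun hy => ⟨?_, fun h => ⟨y, hy, lieInversion_of_orthogonal ?_⟩⟩
    -- Both `z` and its image lie in the isotropic `c`, so their difference, a multiple of the
    -- non-null `a`, is null; hence `z ⊥ a`.
    · rintro ⟨z, hz, rfl⟩
      have h1 : form (z - lieInversion a z) (z - lieInversion a z) = 0 :=
        hc.2 _ (sub_mem hz hy) _ (sub_mem hz hy)
      rw [lieInversion_apply, sub_sub_cancel, map_smul, map_smul, LinearMap.smul_apply,
        smul_eq_mul, smul_eq_mul] at h1
      have h2 : form z a = 0 := by
        simpa [ha] using h1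
      rw [lieInversion_of_orthogonal h2, form_comm, h2]
    · rw [form_comm, h]
  rw [hle]
  have hrange := LinearMap.finrank_range_add_finrank_ker ((form a).domRestrict c)
  have h1 : finrank ℝ (LinearMap.range ((form a).domRestrict c)) = 1 := by
    rw [LinearMap.range_eq_top.2, finrank_top, finrank_self]
    intro r
    refine ⟨(r / form x a) • ⟨x, hx⟩, ?_⟩
    rw [map_smul, LinearMap.domRestrict_apply, form_comm a x, smul_eq_mul, div_mul_cancel₀ _ hxa]
  have h2 : finrank ℝ (LinearMap.ker ((form a).domRestrict c)) =
      finrank ℝ (c ⊓ LinearMap.ker (form a) : Submodule ℝ R42) := by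
    rw [LinearMap.ker_domRestrict, ← finrank_map_subtype_eq c, map_comap_subtype]
  rw [h1, hc.1] at hrange
  omega

lemma DupinCyclide.ribaucourRelated_of_map_eq {Δ Δ' : DupinCyclide} {τ : Equiv.Perm (Fin 2)}
    {a : R42} (ha : form a a ≠ 0) (h : ∀ i, Δ'.plane (τ i) = (Δ.plane i).map (lieInversion a)) :
    Δ.RibaucourRelated Δ' := by
  choose s hs hs0 hsn using fun i => (Δ.isPlane21 i).exists_null
  choose b hb hbΔ _ using fun i => (Δ.isPlane21 i).exists_nullFrame (hs i) (hs0 i) (hsn i)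
  let b' : Fin 2 → Fin 3 → R42 := fun i k => lieInversion a (b i k)
  have hb' : ∀ i, IsNullFrame (b' i) := fun i => (hb i).map_lieInversion ha
  have hbΔ' : ∀ i, span ℝ (Set.range (b' i)) = Δ'.plane (τ i) := fun i => by
    rw [h, ← hbΔ, map_span, ← Set.range_comp]
    rfl
  let f : ℝ × ℝ → Submodule ℝ R42 := fun z => span ℝ (Set.range fun i => conic (b i) (coord i z))
  let f' : ℝ × ℝ → Submodule ℝ R42 := fun z =>
    span ℝ (Set.range fun i => conic (b' i) (coord i z))
  have hff' : ∀ z, f' z = (f z).map (lieInversion a) := fun z => by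
    simp only [f, f', map_span, ← Set.range_comp, Function.comp_def, lieInversion_conic, b']
  -- Otherwise `a` would be orthogonal to both conics, hence to both planes, and would vanish.
  obtain ⟨i, t, hit⟩ : ∃ i t, form (conic (b i) t) a ≠ 0 := by
    by_contra! h0
    refine ha ?_
    rw [Δ.eq_zero_of_orthogonal (a := a) fun i x hx => ?_]
    · simp
    have hle : span ℝ (Set.range (b i)) ≤ LinearMap.ker (form a) :=
      (span_conic_image Set.infinite_univ).trans <| span_le.2 <| by
        rintro _ ⟨t, -, rfl⟩
        rw [SetLike.mem_coe, LinearMap.mem_ker, form_comm, h0]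
    exact hle (hbΔ i ▸ hx)
  have hcont : Continuous fun z : ℝ × ℝ => form (conic (b i) (coord i z)) a := by
    simp only [form_comm _ a]
    exact (form a).toContinuousLinearMap.continuous.comp
      ((contDiff_conic (b i)).continuous.comp (coord i).continuous)
  -- Centring the patch at `(t, t)` serves either value of `i`.
  have hcoord : coord i (t, t) = t := by fin_cases i <;> rfl
  obtain ⟨ε, hε, hball⟩ := Metric.mem_nhds_iff.1
    (hcont.continuousAt.eventually_ne (x := ((t, t) : ℝ × ℝ)) (by rwa [hcoord]))
  have hf : IsConicForm f (Metric.ball (t, t) ε) b fun i => coord i :=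
    ⟨Metric.isOpen_ball, hb, fun i j hij x hx y hy =>
      Δ.form_eq_zero hij (hbΔ i ▸ hx) (hbΔ j ▸ hy), fun i => (coord i).contDiff.contDiffOn,
      fun _ _ => rfl⟩
  have hf' : IsConicForm f' (Metric.ball (t, t) ε) b' fun i => coord i :=
    ⟨Metric.isOpen_ball, hb', fun i j hij x hx y hy =>
      Δ'.form_eq_zero (τ.injective.ne hij) (hbΔ' i ▸ hx) (hbΔ' j ▸ hy),
      fun i => (coord i).contDiff.contDiffOn, fun _ _ => rfl⟩
  refine ⟨Metric.ball (t, t) ε, f, f', Metric.isOpen_ball,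
    (convex_ball _ _).isConnected (Metric.nonempty_ball.2 hε), fun z _ => ?_, fun z _ => ?_,
    hf.isLegendreMap fun p _ X hX => eq_zero_of_fderiv_coord hX,
    hf'.isLegendreMap fun p _ X hX => eq_zero_of_fderiv_coord hX, fun z hz => ?_,
    fun z hz X => ?_⟩
  · exact ⟨_, fun i => ⟨hbΔ i ▸ conic_mem_span (b i) _, (hb i).conic_ne_zero _,
      (hb i).form_conic_conic _⟩, rfl⟩
  · refine ⟨fun j => conic (b' (τ.symm j)) (coord (τ.symm j) z), fun j => ⟨?_,
      (hb' _).conic_ne_zero _, (hb' _).form_conic_conic _⟩, ?_⟩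
    · have := hbΔ' (τ.symm j)
      rw [τ.apply_symm_apply] at this
      rw [← this]
      exact conic_mem_span (b' (τ.symm j)) _
    · change span ℝ (Set.range fun i => conic (b' i) (coord i z)) = _
      rw [← τ.symm.surjective.range_comp]
      rfl
  · rw [hff']
    exact finrank_inf_map_lieInversion ha (hf.isContactElement hz) (hf.conic_mem hz i) (hball hz)
  · rw [hf.isCurvatureDirection_iff hz, hf'.isCurvatureDirection_iff hz]

end LieSphere

theorem mainTheorem4 (Δ Δ' : LieSphere.DupinCyclide) :
    Δ.RibaucourRelated Δ' ↔
      ∃ τ : Equiv.Perm (Fin 2), ∃ σ : LieSphere.R42 →ₗ[ℝ] LieSphere.R42,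
        LieSphere.IsLieInversion σ ∧ ∀ i : Fin 2, Δ'.plane (τ i) = (Δ.plane i).map σ := by
  constructor
  · exact LieSphere.DupinCyclide.RibaucourRelated.exists_lieInversion
  · rintro ⟨τ, σ, ⟨a, ha, rfl⟩, h⟩
    exact LieSphere.DupinCyclide.ribaucourRelated_of_map_eq ha h
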